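/- **Setting.** Let $N,N'\ge 0$ be integers. For $x=(q,p)\in\mathbb R^{2N}$ (coordinates ordered as $q_1,p_1,\dots,q_N,p_N$) let $W(x)=e^{-i x^T\Omega R}$ be the Weyl operator on $L^2(\mathbb R^N)$, i.e. $(W(x)\psi)(t)=e^{i(p\cdot t-\frac12 p\cdot q)}\psi(t-q)$, where $R=(Q_1,P_1,\dots,Q_N,P_N)^T$ is the vector of canonical position and momentum operators and $\Omega=\bigoplus_{j=1}^N\begin{pmatrix}0&1\\-1&0\end{pmatrix}$. * An *observable* on $\mathbb R^M$ is a normalised positive operator valued measure $E:\mathcal B(\mathbb R^M)\to\mathcal L(L^2(\mathbb R^N))$. It is *Gaussian* if there are a real $2N\times M$ matrix $K$, a real $M\times M$ matrix $L$ with $L-iK^T\Omega K\ge 0$, and $m\in\mathbb R^M$ such that $\int e^{i p^Tx}\,dE(x)=e^{-\frac14p^TLp-i m^Tp}\,W(Kp)$ for all $p\in\mathbb R^M$. It is a *generalised quadrature* if $M=1$ and, for some $k\in\mathbb R^{2N}$, $\int e^{ipx}\,dE(x)=W(pk)$ for all $p\in\mathbb R$. * A *channel* is a unital, completely positive, normal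 (weak-$*$ continuous) linear map $\Lambda:\mathcal L(L^2(\mathbb R^{N'}))\to\mathcal L(L^2(\mathbb R^{N}))$. It is *Gaussian* if there are a real $2N\times 2N'$ matrix $A$, a real $2N'\times 2N'$ matrix $B$ with $B+i\Omega-iA^T\Omega A\ge0$, and $c\in\mathbb R^{2N'}$ such that $\Lambda(W(x))=e^{-\frac14x^TBx-ic^Tx}\,W(Ax)$ for all $x\in\mathbb R^{2N'}$. For an observable $E$, $\Lambda(E)$ is the observable $X\mapsto\Lambda(E(X))$; for a set $\mathcal M$ of observables, $\Lambda(\mathcal M)=\{\Lambda(E):E\in\mathcal M\}$. * A *Gaussian postprocessing* from $\mathbb R^M$ to $\mathbb R^{M'}$ is a Markov kernel $f$ such that, for some real $M\times M'$ matrix $A$, some real positive semidefinite $M'\times M'$ matrix $B$ and some $c\in\mathbb R^{M'}$, $\int e^{ip^Ty}f(dy,x)=e^{-\frac14p^TBp-ic^Tp}\,e^{i(Ap)^Tx}$ for all $p\in\mathbb R^{M'}$ and $x\in\mathbb R^M$. It turns an observable $G$ on $\mathbb R^M$ into the observable $X\mapsto\int f(X,x)\,dG(x)$ on $\mathbb R^{M'}$.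 * A set $\mathcal M$ of observables (with possibly different outcome spaces $\mathbb R^M$) is *Gaussian compatible* if there is one Gaussian observable $G$ from which every $E\in\mathcal M$ is obtained by a Gaussian postprocessing. A Gaussian channel $\Lambda$ *breaks the Gaussian incompatibility* of a set $\mathcal M$ of Gaussian observables if $\Lambda(\mathcal M)$ is Gaussian compatible. **Proposition.** For a Gaussian channel $\Lambda$ the following conditions are equivalent: 1. $\Lambda$ breaks the Gaussian incompatibility of the set of all Gaussian observables (i.e. $\Lambda$ is Gaussian incompatibility breaking); 2. $\Lambda$ breaks the Gaussian incompatibility of each pair of Gaussian observables; 3. $\Lambda$ breaks the Gaussian incompatibility of the set of all generalised quadratures; 4. $\Lambda$ breaks the Gaussian incompatibility of each pair of generalised quadratures. -/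

import Mathlib

open MeasureTheory ProbabilityTheory Matrix
open scoped ComplexOrder InnerProductSpace CStarAlgebra ENNReal

namespace GaussianBreaking

/-! ### Phase space, Hilbert space, Weyl operators -/

/-- The Hilbert space `L²(ℝᴺ)` of a system with `N` modes. -/
abbrev ModeSpace (N : ℕ) : Type := Lp ℂ 2 (volume : Measure (Fin N → ℝ))

/-- Index set of the `2N` phase space coordinates: `(0, j)` is the index of `q_j` and `(1, j)` the
index of `p_j`. -/
abbrev PhaseIdx (N : ℕ) : Type := Fin 2 × Fin N

/-- The phase space `ℝ²ᴺ`. -/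
abbrev Phase (N : ℕ) : Type := PhaseIdx N → ℝ

/-- The symplectic matrix, a direct sum of `N` blocks `[0, 1; -1, 0]`. -/
def Omega (N : ℕ) : Matrix (PhaseIdx N) (PhaseIdx N) ℝ :=
  Matrix.blockDiagonal fun _ : Fin N => !![0, 1; -1, 0]

/-- The position part `q` of a phase space point. -/
def posPart {N : ℕ} (x : Phase N) : Fin N → ℝ := fun j => x (0, j)

/-- The momentum part `p` of a phase space point. -/
def momPart {N : ℕ} (x : Phase N) : Fin N → ℝ := fun j => x (1, j)

/-- The pointwise action `t ↦ e^{i (p·t - p·q/2)} ψ(t - q)` of the Weyl operator with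
`x = (q, p)`. -/
noncomputable def weylFun {N : ℕ} (x : Phase N) (ψ : (Fin N → ℝ) → ℂ) : (Fin N → ℝ) → ℂ :=
  fun t => Complex.exp (Complex.I *
    ((momPart x ⬝ᵥ t - momPart x ⬝ᵥ posPart x / 2 : ℝ) : ℂ)) * ψ (t - posPart x)

lemma norm_weylFun {N : ℕ} (x : Phase N) (ψ : (Fin N → ℝ) → ℂ) (t : Fin N → ℝ) :
    ‖weylFun x ψ t‖ = ‖ψ (t - posPart x)‖ := by
  rw [weylFun, norm_mul, mul_comm Complex.I, Complex.norm_exp_ofReal_mul_I, one_mul]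

lemma weylFun_congr {N : ℕ} (x : Phase N) {ψ φ : (Fin N → ℝ) → ℂ} (h : ψ =ᵐ[volume] φ) :
    weylFun x ψ =ᵐ[volume] weylFun x φ := by
  have h' := (measurePreserving_sub_right (volume : Measure (Fin N → ℝ))
    (posPart x)).quasiMeasurePreserving.ae_eq_comp h
  filter_upwards [h'] with t ht
  simp only [Function.comp_apply] at ht
  simp only [weylFun, ht]

lemma memLp_weylFun {N : ℕ} (x : Phase N) {ψ : (Fin N → ℝ) → ℂ} (h : MemLp ψ 2 volume) :
    MemLp (weylFun x ψ) 2 volume := by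
  have h' : MemLp (ψ ∘ fun t => t - posPart x) 2 volume :=
    h.comp_measurePreserving (measurePreserving_sub_right volume (posPart x))
  refine h'.of_le ?_ (Filter.Eventually.of_forall fun t => (norm_weylFun x ψ t).le)
  refine AEStronglyMeasurable.mul (Continuous.aestronglyMeasurable ?_) h'.1
  unfold dotProduct
  fun_prop

/-- The Weyl operator `W(x) = e^{-i xᵀ Ω R} = e^{i ∑ⱼ (pⱼ Qⱼ - qⱼ Pⱼ)}` for `x = (q, p)`, that is,
`(W(x) ψ)(t) = e^{i (p·t - p·q/2)} ψ(t - q)`. -/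
noncomputable def weyl {N : ℕ} (x : Phase N) : ModeSpace N →L[ℂ] ModeSpace N :=
  LinearIsometry.toContinuousLinearMap
    { toFun := fun ψ => (memLp_weylFun x (Lp.memLp ψ)).toLp (weylFun x ψ)
      map_add' := fun ψ φ => by
        rw [← MemLp.toLp_add]
        refine MemLp.toLp_congr _ _ ((weylFun_congr x (Lp.coeFn_add ψ φ)).trans
          (Filter.Eventually.of_forall fun t => ?_))
        simp [weylFun, mul_add]
      map_smul' := fun c ψ => by
        rw [RingHom.id_apply, ← MemLp.toLp_const_smul]
        refine MemLp.toLp_congr _ _ ((weylFun_congr x (Lp.coeFn_smul c ψ)).trans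
          (Filter.Eventually.of_forall fun t => ?_))
        simp only [weylFun, Pi.smul_apply, smul_eq_mul]
        ring
      norm_map' := fun ψ => by
        change ‖(memLp_weylFun x (Lp.memLp ψ)).toLp (weylFun x ψ)‖ = ‖ψ‖
        rw [Lp.norm_toLp, Lp.norm_def]
        congr 1
        rw [← eLpNorm_comp_measurePreserving (Lp.aestronglyMeasurable ψ)
          (measurePreserving_sub_right (volume : Measure (Fin N → ℝ)) (posPart x))]
        exact eLpNorm_congr_norm_ae (Filter.Eventually.of_forall fun t => norm_weylFun x ψ t) }

/-! ### Observables (positive operator valued measures) -/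

variable {H H' : Type*} [NormedAddCommGroup H] [InnerProductSpace ℂ H] [CompleteSpace H]
  [NormedAddCommGroup H'] [InnerProductSpace ℂ H'] [CompleteSpace H']

/-- A (normalised) positive operator valued measure on `α` with values in the bounded operators on
`H`, countably additive in the weak operator topology. The value at a non-measurable set is `0`
by convention. -/
structure Observable (α : Type*) [MeasurableSpace α] (H : Type*) [NormedAddCommGroup H]
    [InnerProductSpace ℂ H] [CompleteSpace H] where
  /-- The operator attached to a set. -/
  toFun : Set α → (H →L[ℂ] H)
  nonneg : ∀ X, 0 ≤ toFun X
  not_measurable : ∀ X, ¬ MeasurableSet X → toFun X = 0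
  univ : toFun Set.univ = 1
  hasSum_iUnion : ∀ X : ℕ → Set α, (∀ i, MeasurableSet (X i)) →
    Pairwise (Function.onFun Disjoint X) →
      ∀ φ ψ : H, HasSum (fun i => ⟪φ, toFun (X i) ψ⟫_ℂ) ⟪φ, toFun (⋃ i, X i) ψ⟫_ℂ

namespace Observable

variable {α β : Type*} [MeasurableSpace α] [MeasurableSpace β]

lemma empty (E : Observable α H) (φ ψ : H) : ⟪φ, E.toFun ∅ ψ⟫_ℂ = 0 := by
  have h := (E.hasSum_iUnion (fun _ => ∅) (fun _ => MeasurableSet.empty)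
    (fun _ _ _ => by simp [Function.onFun]) φ ψ).summable
  exact (summable_const_iff _).1 h

lemma re_nonneg (E : Observable α H) (X : Set α) (ψ : H) : 0 ≤ (⟪ψ, E.toFun X ψ⟫_ℂ).re :=
  ((ContinuousLinearMap.nonneg_iff_isPositive _).1 (E.nonneg X)).re_inner_nonneg_right ψ

/-- The finite measure `X ↦ ⟨ψ, E(X) ψ⟩`. -/
noncomputable def diagMeasure (E : Observable α H) (ψ : H) : Measure α :=
  Measure.ofMeasurable (fun X _ => ENNReal.ofReal (⟪ψ, E.toFun X ψ⟫_ℂ).re)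
    (by simp [E.empty]) (fun X hX hd => by
      have h := Complex.hasSum_re (E.hasSum_iUnion X hX hd ψ ψ)
      change ENNReal.ofReal (⟪ψ, E.toFun (⋃ i, X i) ψ⟫_ℂ).re = _
      rw [← h.tsum_eq, ENNReal.ofReal_tsum_of_nonneg (fun i => E.re_nonneg _ _) h.summable])

lemma diagMeasure_apply (E : Observable α H) (ψ : H) {X : Set α} (hX : MeasurableSet X) :
    E.diagMeasure ψ X = ENNReal.ofReal (⟪ψ, E.toFun X ψ⟫_ℂ).re :=
  Measure.ofMeasurable_apply X hX

/-- `E.HasIntegral f T` says that `∫ f dE = T` as a weak operator integral; as `H` is a complex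
Hilbert space, the operator `T` is determined by its diagonal matrix elements. -/
def HasIntegral (E : Observable α H) (f : α → ℂ) (T : H →L[ℂ] H) : Prop :=
  ∀ ψ : H, Integrable f (E.diagMeasure ψ) ∧ ∫ x, f x ∂(E.diagMeasure ψ) = ⟪ψ, T ψ⟫_ℂ

/-- `E` is the postprocessing of `G` by the Markov kernel `f`: `E(X) = ∫ f(X, x) dG(x)`. -/
def IsPostprocessing (E : Observable β H) (G : Observable α H) (f : Kernel α β) : Prop :=
  ∀ X, MeasurableSet X → G.HasIntegral (fun x => ((f x).real X : ℂ)) (E.toFun X)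

end Observable

/-! ### Channels -/

/-- A quantum channel in the Heisenberg picture: a unital completely positive normal linear map
`𝓛(H') → 𝓛(H)`. The normal functionals (trace class operators) are the maps
`A ↦ ∑ₙ ⟨ξₙ, A ηₙ⟩` with square summable `ξ` and `η`; normality (weak-* continuity) says that
the composition of such a functional with the channel is again of this form. -/
structure Channel (H' H : Type*) [NormedAddCommGroup H] [InnerProductSpace ℂ H] [CompleteSpace H]
    [NormedAddCommGroup H'] [InnerProductSpace ℂ H'] [CompleteSpace H'] where
  /-- The underlying completely positive map. -/
  toCP : (H' →L[ℂ] H') →CP (H →L[ℂ] H)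
  unital : toCP 1 = 1
  normal : ∀ ξ η : ℕ → H, Summable (fun n => ‖ξ n‖ ^ 2) → Summable (fun n => ‖η n‖ ^ 2) →
    ∃ ξ' η' : ℕ → H', Summable (fun n => ‖ξ' n‖ ^ 2) ∧ Summable (fun n => ‖η' n‖ ^ 2) ∧
      ∀ A : H' →L[ℂ] H', ∑' n, ⟪ξ n, toCP A (η n)⟫_ℂ = ∑' n, ⟪ξ' n, A (η' n)⟫_ℂ

lemma norm_inner_le_of_nonneg {V : Type*} [NormedAddCommGroup V] [InnerProductSpace ℂ V]
    {T : V →L[ℂ] V} (hT : 0 ≤ T) (ξ η : V) :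
    ‖⟪ξ, T η⟫_ℂ‖ ≤ (⟪ξ, T ξ⟫_ℂ).re + (⟪η, T η⟫_ℂ).re := by
  have hp := (ContinuousLinearMap.nonneg_iff_isPositive _).1 hT
  have key : ∀ c : ℂ, ‖c‖ = 1 → -2 * (c * ⟪ξ, T η⟫_ℂ).re ≤
      (⟪ξ, T ξ⟫_ℂ).re + (⟪η, T η⟫_ℂ).re := by
    intro c hc
    have h0 : 0 ≤ (⟪ξ + c • η, T (ξ + c • η)⟫_ℂ).re := hp.re_inner_nonneg_right _
    have hsym : ⟪η, T ξ⟫_ℂ = (starRingEnd ℂ) ⟪ξ, T η⟫_ℂ := by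
      rw [inner_conj_symm]; exact (hp.inner_left_eq_inner_right η ξ).symm
    have hcc : (starRingEnd ℂ) c * c = 1 := by
      rw [mul_comm, Complex.mul_conj, Complex.normSq_eq_norm_sq, hc]; simp
    have hexp : ⟪ξ + c • η, T (ξ + c • η)⟫_ℂ = ⟪ξ, T ξ⟫_ℂ + c * ⟪ξ, T η⟫_ℂ +
        (starRingEnd ℂ) (c * ⟪ξ, T η⟫_ℂ) + ⟪η, T η⟫_ℂ := by
      rw [map_add, map_smul, inner_add_left, inner_add_right, inner_add_right, inner_smul_right,
        inner_smul_left, inner_smul_left, inner_smul_right, hsym, map_mul]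
      linear_combination ⟪η, T η⟫_ℂ * hcc
    rw [hexp] at h0
    simp only [Complex.add_re, Complex.conj_re] at h0
    linarith
  have hξ : 0 ≤ (⟪ξ, T ξ⟫_ℂ).re := hp.re_inner_nonneg_right ξ
  have hη : 0 ≤ (⟪η, T η⟫_ℂ).re := hp.re_inner_nonneg_right η
  by_cases hz : ⟪ξ, T η⟫_ℂ = 0
  · rw [hz, norm_zero]; linarith
  · have hn : (‖⟪ξ, T η⟫_ℂ‖ : ℂ) ≠ 0 := by simpa using hz
    have h := key (-((starRingEnd ℂ) ⟪ξ, T η⟫_ℂ / ‖⟪ξ, T η⟫_ℂ‖)) (by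
      rw [norm_neg, norm_div, RCLike.norm_conj, Complex.norm_real, norm_norm]
      exact div_self (by simpa using hz))
    have he : -((starRingEnd ℂ) ⟪ξ, T η⟫_ℂ / ‖⟪ξ, T η⟫_ℂ‖) * ⟪ξ, T η⟫_ℂ =
        ((-‖⟪ξ, T η⟫_ℂ‖ : ℝ) : ℂ) := by
      have := Complex.conj_mul' ⟪ξ, T η⟫_ℂ
      push_cast
      field_simp
      rw [this]
    rw [he, Complex.ofReal_re] at h
    linarith [norm_nonneg ⟪ξ, T η⟫_ℂ]

/-- The image observable `Λ(E) : X ↦ Λ(E(X))`. -/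
noncomputable def Channel.map {α : Type*} [MeasurableSpace α] (Λ : Channel H' H)
    (E : Observable α H') : Observable α H where
  toFun X := Λ.toCP (E.toFun X)
  nonneg X := map_nonneg Λ.toCP (E.nonneg X)
  not_measurable X hX := by rw [E.not_measurable X hX, map_zero]
  univ := by rw [E.univ, Λ.unital]
  hasSum_iUnion X hX hd φ ψ := by
    obtain ⟨ξ, η, hξ, hη, h⟩ := Λ.normal (Pi.single 0 φ) (Pi.single 0 ψ)
      (summable_of_ne_finset_zero (s := {0}) fun n hn => by
        have : n ≠ 0 := by simpa using hn
        simp [this])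
      (summable_of_ne_finset_zero (s := {0}) fun n hn => by
        have : n ≠ 0 := by simpa using hn
        simp [this])
    have h' : ∀ A : H' →L[ℂ] H', ⟪φ, Λ.toCP A ψ⟫_ℂ = ∑' n, ⟪ξ n, A (η n)⟫_ℂ := by
      intro A
      rw [← h A, tsum_eq_single 0]
      · simp
      · intro n hn
        simp [hn]
    simp only [h']
    have hdiag : ∀ θ : H', HasSum (fun i => (⟪θ, E.toFun (X i) θ⟫_ℂ).re)
        (⟪θ, E.toFun (⋃ i, X i) θ⟫_ℂ).re := fun θ =>
      Complex.hasSum_re (E.hasSum_iUnion X hX hd θ θ)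
    have hle : ∀ (Y : Set α) (θ : H'), (⟪θ, E.toFun Y θ⟫_ℂ).re ≤ ‖θ‖ ^ 2 := by
      intro Y θ
      by_cases hY : MeasurableSet Y
      · have hsum := E.hasSum_iUnion (fun n => if n = 0 then Y else if n = 1 then Yᶜ else ∅)
          (fun n => by split_ifs <;> simp [hY])
          (by
            intro i j hij
            simp only [Function.onFun]
            split_ifs <;> simp_all [disjoint_compl_left, disjoint_compl_right]) θ θ
        have hU : (⋃ n : ℕ, if n = 0 then Y else if n = 1 then Yᶜ else ∅) = Set.univ := by
          refine Set.eq_univ_of_forall fun a => Set.mem_iUnion.2 ?_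
          by_cases ha : a ∈ Y
          · exact ⟨0, by simpa using ha⟩
          · exact ⟨1, by simpa using ha⟩
        rw [hU, E.univ] at hsum
        have h1 := (Complex.hasSum_re hsum)
        have h2 := le_hasSum h1 0 (fun j _ => E.re_nonneg _ _)
        have h3 : (⟪θ, (1 : H' →L[ℂ] H') θ⟫_ℂ).re = ‖θ‖ ^ 2 := by
          rw [one_apply_eq_self]
          exact inner_self_eq_norm_sq (𝕜 := ℂ) θ
        rw [h3] at h2
        simpa using h2
      · rw [E.not_measurable Y hY]
        simp
    have hsumm : Summable fun z : ℕ × ℕ => ⟪ξ z.1, E.toFun (X z.2) (η z.1)⟫_ℂ := by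
      refine Summable.of_norm_bounded (g := fun z : ℕ × ℕ =>
        (⟪ξ z.1, E.toFun (X z.2) (ξ z.1)⟫_ℂ).re + (⟪η z.1, E.toFun (X z.2) (η z.1)⟫_ℂ).re) ?_
        (fun z => norm_inner_le_of_nonneg (E.nonneg _) _ _)
      have aux : ∀ ζ : ℕ → H', Summable (fun n => ‖ζ n‖ ^ 2) →
          Summable fun z : ℕ × ℕ => (⟪ζ z.1, E.toFun (X z.2) (ζ z.1)⟫_ℂ).re := by
        intro ζ hζ
        rw [summable_prod_of_nonneg (fun z => E.re_nonneg _ _)]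
        refine ⟨fun n => (hdiag (ζ n)).summable, ?_⟩
        simp only [(hdiag (ζ _)).tsum_eq]
        exact Summable.of_nonneg_of_le (fun n => E.re_nonneg _ _) (fun n => hle _ _) hζ
      exact (aux ξ hξ).add (aux η hη)
    have e1 := (hsumm.hasSum.prod_fiberwise fun n =>
      E.hasSum_iUnion X hX hd (ξ n) (η n)).tsum_eq
    rw [e1]
    have hsw : HasSum (fun z : ℕ × ℕ => ⟪ξ z.2, E.toFun (X z.1) (η z.2)⟫_ℂ)
        (∑' z : ℕ × ℕ, ⟪ξ z.1, E.toFun (X z.2) (η z.1)⟫_ℂ) :=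
      (Equiv.prodComm ℕ ℕ).hasSum_iff (f := fun z : ℕ × ℕ =>
        ⟪ξ z.1, E.toFun (X z.2) (η z.1)⟫_ℂ) |>.2 hsumm.hasSum
    exact hsw.prod_fiberwise fun i => (hsw.summable.prod_factor i).hasSum

/-! ### Gaussian channels, observables and postprocessings -/

/-- A channel is Gaussian if `Λ(W(x)) = e^{-xᵀBx/4 - i cᵀx} W(Ax)` for some real `A`, `B`, `c` with
`B + iΩ - i AᵀΩA ≥ 0`. -/
def Channel.IsGaussian {N' N : ℕ} (Λ : Channel (ModeSpace N') (ModeSpace N)) : Prop :=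
  ∃ (A : Matrix (PhaseIdx N) (PhaseIdx N') ℝ) (B : Matrix (PhaseIdx N') (PhaseIdx N') ℝ)
    (c : Phase N'),
    (B.map Complex.ofReal + Complex.I • (Omega N').map Complex.ofReal -
      Complex.I • (Aᵀ * Omega N * A).map Complex.ofReal).PosSemidef ∧
    ∀ x : Phase N', Λ.toCP (weyl x) =
      Complex.exp (-((x ⬝ᵥ B *ᵥ x : ℝ) : ℂ) / 4 - Complex.I * ((c ⬝ᵥ x : ℝ) : ℂ)) • weyl (A *ᵥ x)

/-- The observable `E` on `ℝᴹ` has parameters `(K, L, m)`: its Fourier transform is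
`∫ e^{i pᵀx} dE(x) = e^{-pᵀLp/4 - i mᵀp} W(Kp)`. -/
def HasParams {N M : ℕ} (E : Observable (Fin M → ℝ) (ModeSpace N))
    (K : Matrix (PhaseIdx N) (Fin M) ℝ) (L : Matrix (Fin M) (Fin M) ℝ) (m : Fin M → ℝ) : Prop :=
  ∀ p : Fin M → ℝ, E.HasIntegral (fun x => Complex.exp (Complex.I * ((p ⬝ᵥ x : ℝ) : ℂ)))
    (Complex.exp (-((p ⬝ᵥ L *ᵥ p : ℝ) : ℂ) / 4 - Complex.I * ((m ⬝ᵥ p : ℝ) : ℂ)) • weyl (K *ᵥ p))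

/-- An observable is Gaussian if it has parameters `(K, L, m)` with `L - i KᵀΩK ≥ 0`. -/
def IsGaussianObs {N M : ℕ} (E : Observable (Fin M → ℝ) (ModeSpace N)) : Prop :=
  ∃ (K : Matrix (PhaseIdx N) (Fin M) ℝ) (L : Matrix (Fin M) (Fin M) ℝ) (m : Fin M → ℝ),
    (L.map Complex.ofReal - Complex.I • (Kᵀ * Omega N * K).map Complex.ofReal).PosSemidef ∧
    HasParams E K L m

/-- A Markov kernel `f` from `ℝᴹ` to `ℝᴹ'` is a Gaussian postprocessing if
`∫ e^{i pᵀy} f(dy, x) = e^{-pᵀBp/4 - i cᵀp} e^{i (Ap)ᵀx}` for some real `A`, `B ≥ 0` and `c`. -/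
def IsGaussianKernel {M M' : ℕ} (f : Kernel (Fin M → ℝ) (Fin M' → ℝ)) : Prop :=
  IsMarkovKernel f ∧
  ∃ (A : Matrix (Fin M) (Fin M') ℝ) (B : Matrix (Fin M') (Fin M') ℝ) (c : Fin M' → ℝ),
    B.PosSemidef ∧ ∀ (p : Fin M' → ℝ) (x : Fin M → ℝ),
      ∫ y, Complex.exp (Complex.I * ((p ⬝ᵥ y : ℝ) : ℂ)) ∂(f x) =
        Complex.exp (-((p ⬝ᵥ B *ᵥ p : ℝ) : ℂ) / 4 - Complex.I * ((c ⬝ᵥ p : ℝ) : ℂ)) *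
          Complex.exp (Complex.I * (((A *ᵥ p) ⬝ᵥ x : ℝ) : ℂ))

/-! ### Gaussian compatibility -/

/-- An observable of an `N`-mode system with outcome set `ℝᴹ` for some `M`. -/
abbrev EuclObs (N : ℕ) : Type := Σ M : ℕ, Observable (Fin M → ℝ) (ModeSpace N)

/-- The set of all Gaussian observables of an `N`-mode system. -/
def gaussianObservables (N : ℕ) : Set (EuclObs N) := {E | IsGaussianObs E.2}

/-- The set of all generalised quadratures: the observables `E` on `ℝ` with
`∫ e^{i p x} dE(x) = W(p k) = e^{-i p kᵀΩR}` for some `k ∈ ℝ²ᴺ`. -/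
def generalisedQuadratures (N : ℕ) : Set (EuclObs N) :=
  {E | ∃ (k : Phase N) (F : Observable (Fin 1 → ℝ) (ModeSpace N)),
    HasParams F (Matrix.replicateCol (Fin 1) k) 0 0 ∧ E = ⟨1, F⟩}

/-- A set of observables is Gaussian compatible if all its members are Gaussian postprocessings of
one Gaussian observable. -/
def GaussianCompatible {N : ℕ} (S : Set (EuclObs N)) : Prop :=
  ∃ (M : ℕ) (G : Observable (Fin M → ℝ) (ModeSpace N)), IsGaussianObs G ∧
    ∀ E ∈ S, ∃ f : Kernel (Fin M → ℝ) (Fin E.1 → ℝ),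
      IsGaussianKernel f ∧ E.2.IsPostprocessing G f

/-- The channel `Λ` breaks the Gaussian incompatibility of the set `S`: the image `Λ(S)` is
Gaussian compatible. -/
def BreaksGaussianIncompatibility {N' N : ℕ} (Λ : Channel (ModeSpace N') (ModeSpace N))
    (S : Set (EuclObs N')) : Prop :=
  GaussianCompatible ((fun E : EuclObs N' => (⟨E.1, Λ.map E.2⟩ : EuclObs N)) '' S)

end GaussianBreaking

/-! Let `Λ` have parameters `(A, B, c)`. All four conditions are equivalent to the single matrix
inequality `B - i AᵀΩA ≥ 0`. The implications from larger to smaller sets of observables are formal,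
so it suffices that 4 forces the inequality and that the inequality forces 1.

Inequality to 1: it is exactly the admissibility of `(A, B, c)` as parameters of a Gaussian
observable `G` on `ℝ^{2N'}`. A Gaussian `E` with parameters `(K, L, m)` is sent by `Λ` to one with
parameters `(AK, L + KᵀBK, m + Kᵀc)`, and these are also the parameters of `G` postprocessed with
matrix `K`, noise `L` and shift `m` (`breaksGaussianIncompatibility_of_posSemidef`). Existence of
`G` rests on Bochner's theorem together with a reconstruction of operators from quadratic forms
(`exists_hasParams`).

4 to inequality: let the images of the quadratures along `k₁`, `k₂` be postprocessings of an
observable with parameters `(K, L, m)`, with vectors `a₁`, `a₂` and noises `b₁, b₂ ≥ 0`. Comparing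
Fourier transforms gives `kⱼᵀBkⱼ = bⱼ + aⱼᵀLaⱼ`, and comparing Weyl commutators gives `(Ak₁)ᵀΩ(Ak₂)
= (Ka₁)ᵀΩ(Ka₂)`. Positivity of `L - iKᵀΩK` on `a₁ + i a₂` therefore yields that of `B - iAᵀΩA` on
`k₁ + i k₂` (`posSemidef_of_breaks_pairs`). -/

namespace GaussianBreaking

/-! ### Bochner's theorem in finite dimension. -/

section Bochner

open Filter Topology FourierTransform

/-- A function on an additive group is positive definite if all the matrices `φ(xₖ - xⱼ)` are
positive semidefinite. -/
def IsPosDefFun {E : Type*} [AddGroup E] (φ : E → ℂ) : Prop :=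
  ∀ (n : ℕ) (x : Fin n → E), (Matrix.of fun j k => φ (x k - x j)).PosSemidef

variable {E : Type*} [NormedAddCommGroup E] [InnerProductSpace ℝ E] [FiniteDimensional ℝ E]
  [MeasurableSpace E] [BorelSpace E]

lemma IsPosDefFun.sum_nonneg {E : Type*} [AddGroup E] {φ : E → ℂ} (h : IsPosDefFun φ) {n : ℕ}
    (x : Fin n → E) : 0 ≤ ∑ j, ∑ k, φ (x k - x j) := by
  have := (Matrix.posSemidef_iff_dotProduct_mulVec.1 (h n x)).2 (fun _ => 1)
  simpa [dotProduct, mulVec] using this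

lemma IsPosDefFun.mul_char {E : Type*} [NormedAddCommGroup E] [InnerProductSpace ℝ E]
    {φ : E → ℂ} (h : IsPosDefFun φ) (ξ : E) :
    IsPosDefFun fun p => φ p * Complex.exp (Complex.I * (⟪p, ξ⟫_ℝ : ℂ)) := by
  intro n x
  have h2 : (Matrix.vecMulVec (star fun k => Complex.exp (Complex.I * (⟪x k, ξ⟫_ℝ : ℂ)))
      (fun k => Complex.exp (Complex.I * (⟪x k, ξ⟫_ℝ : ℂ)))).PosSemidef :=
    Matrix.posSemidef_vecMulVec_star_self _
  refine (congrArg Matrix.PosSemidef (Matrix.ext fun j k => ?_)).mpr ((h n x).hadamard h2)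
  simp only [of_apply, hadamard_apply, vecMulVec_apply, Pi.star_apply, RCLike.star_def,
    ← Complex.exp_conj]
  rw [← Complex.exp_add, inner_sub_left]
  congr 2
  rw [map_mul, Complex.conj_I, Complex.conj_ofReal]
  push_cast
  ring

/-- Averaging the positive sum `∑ φ(xₖ - xⱼ)` over `n` independent samples from `γ` gives `n φ(0) +
(n² - n) J ≥ 0`. Large `n` forces `Re J ≥ 0`, and `n = 2` already gives `Im J = 0`. -/
lemma IsPosDefFun.integral_prod_nonneg {φ : E → ℂ} (h : IsPosDefFun φ) (hc : Continuous φ)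
    (h0 : 0 ≤ φ 0) {C : ℝ}
    (hb : ∀ p, ‖φ p‖ ≤ C) (γ : Measure E) [IsProbabilityMeasure γ] :
    0 ≤ ∫ z, φ (z.2 - z.1) ∂(γ.prod γ) := by
  set J := ∫ z, φ (z.2 - z.1) ∂(γ.prod γ)
  have key : ∀ n : ℕ, 0 ≤ (n : ℂ) * φ 0 + ((n * n - n : ℝ) : ℂ) * J := by
    intro n
    have hpos : 0 ≤ ∫ x, (∑ j, ∑ k, φ (x k - x j)) ∂(Measure.pi fun _ : Fin n => γ) :=
      integral_nonneg fun x => h.sum_nonneg x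
    have hint : ∀ j k : Fin n,
        Integrable (fun x => φ (x k - x j)) (Measure.pi fun _ : Fin n => γ) := fun j k =>
      Integrable.of_bound (Continuous.aestronglyMeasurable (by fun_prop)) C
        (Eventually.of_forall fun x => hb _)
    have hjk : ∀ j k : Fin n, ∫ x, φ (x k - x j) ∂(Measure.pi fun _ : Fin n => γ) =
        if j = k then φ 0 else J := by
      intro j k
      split_ifs with hh
      · subst hh; simp
      · have hind := (iIndepFun_pi (μ := fun _ : Fin n => γ) (X := fun _ x => x)
          (fun _ => aemeasurable_id)).indepFun hh
        have hmap := (indepFun_iff_map_prod_eq_prod_map_map (measurable_pi_apply j).aemeasurable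
          (measurable_pi_apply k).aemeasurable).1 hind
        have e : ∀ i : Fin n, (Measure.pi fun _ : Fin n => γ).map (fun x => x i) = γ := fun i =>
          (measurePreserving_eval (fun _ : Fin n => γ) i).map_eq
        rw [e, e] at hmap
        simp only [J]
        rw [← hmap, integral_map (by fun_prop) (Continuous.aestronglyMeasurable (by fun_prop))]
    rw [integral_finsetSum _ fun j _ => integrable_finsetSum _ fun k _ => hint j k] at hpos
    simp_rw [integral_finsetSum _ fun k _ => hint _ k, hjk] at hpos
    convert hpos using 1
    have : ∀ j : Fin n, (∑ k, if j = k then φ 0 else J) = φ 0 + (n - 1) * J := by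
      intro j
      have : ∀ k : Fin n, (if j = k then φ 0 else J) = (if j = k then φ 0 - J else 0) + J := by
        intro k; split_ifs <;> ring
      simp_rw [this, Finset.sum_add_distrib]
      simp
      ring
    simp_rw [this]
    simp
    ring
  rw [Complex.le_def] at h0
  refine Complex.le_def.2 ⟨?_, ?_⟩
  · by_contra! hneg
    simp only [Complex.zero_re] at hneg
    obtain ⟨n, hn⟩ := exists_nat_gt (1 + (φ 0).re / (-J.re))
    have h1 := (Complex.le_def.1 (key n)).1
    simp at h1
    have h3 : 0 < -J.re := by linarith
    have h2 : (φ 0).re < (n - 1) * (-J.re) := by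
      rw [← div_lt_iff₀ h3]; linarith
    have h4 : (0:ℝ) < n := by
      have : 0 ≤ (φ 0).re / (-J.re) := div_nonneg h0.1 h3.le
      linarith
    nlinarith
  · have h1 := (Complex.le_def.1 (key 2)).2
    have h00 : (φ 0).im = 0 := h0.2.symm
    norm_num at h1
    simp [h00] at h1
    simp [h1]

lemma charFun_map_sub_prod_stdGaussian (t : E) :
    charFun (((stdGaussian E).prod (stdGaussian E)).map fun z => z.2 - z.1) t =
      Complex.exp (-‖t‖ ^ 2) := by
  rw [charFun_apply, integral_map (by fun_prop) (Continuous.aestronglyMeasurable (by fun_prop))]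
  have : ∀ z : E × E, Complex.exp ((⟪z.2 - z.1, t⟫_ℝ : ℂ) * Complex.I) =
      Complex.exp ((⟪z.1, -t⟫_ℝ : ℂ) * Complex.I) * Complex.exp ((⟪z.2, t⟫_ℝ : ℂ) * Complex.I) := by
    intro z
    rw [← Complex.exp_add]
    congr 1
    simp [inner_sub_left]
    ring
  simp_rw [this]
  rw [integral_prod_mul (fun x => Complex.exp ((⟪x, -t⟫_ℝ : ℂ) * Complex.I))
    (fun x => Complex.exp ((⟪x, t⟫_ℝ : ℂ) * Complex.I)), ← charFun_apply, ← charFun_apply,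
    charFun_stdGaussian, charFun_stdGaussian, ← Complex.exp_add]
  congr 1
  rw [norm_neg]
  ring

lemma integrable_exp_neg_norm_sq_div_four :
    Integrable fun p : E => Real.exp (-‖p‖ ^ 2 / 4) := by
  have := GaussianFourier.integrable_cexp_neg_mul_sq_norm_add (V := E) (b := 1 / 4) (by norm_num) 0 0
  convert this.re using 2 with p
  have : (-(1 / 4 : ℂ) * ‖p‖ ^ 2 + 0 * ⟪(0:E), p⟫_ℝ) = ((-‖p‖ ^ 2 / 4 : ℝ) : ℂ) := by
    push_cast; ring
  rw [this, ← Complex.ofReal_exp]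
  rfl

/-- A difference of two independent standard Gaussians has density proportional to `e^{-|p|²/4}`.
Integrating `φ` against this weight is thus a double average of `φ(z₂ - z₁)`, to which positive
definiteness applies. The two measures are compared through their characteristic functions. -/
lemma exists_withDensity_gaussian_eq :
    ∃ C : ENNReal, C ≠ ∞ ∧ (volume : Measure E).withDensity
      (fun p => ENNReal.ofReal (Real.exp (-‖p‖ ^ 2 / 4))) =
      C • ((stdGaussian E).prod (stdGaussian E)).map fun z => z.2 - z.1 := by
  set d : ℝ := (Real.pi / (1 / 4)) ^ (Module.finrank ℝ E / 2 : ℝ)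
  have hd : 0 ≤ d := by positivity
  refine ⟨ENNReal.ofReal d, ENNReal.ofReal_ne_top, ?_⟩
  have : IsFiniteMeasure ((volume : Measure E).withDensity
      (fun p => ENNReal.ofReal (Real.exp (-‖p‖ ^ 2 / 4)))) :=
    isFiniteMeasure_withDensity_ofReal integrable_exp_neg_norm_sq_div_four.2
  have : IsFiniteMeasure (ENNReal.ofReal d •
      ((stdGaussian E).prod (stdGaussian E)).map fun z => z.2 - z.1) :=
    Measure.smul_finite _ ENNReal.ofReal_ne_top
  refine Measure.ext_of_charFun (funext fun t => ?_)
  have e1 := GaussianFourier.integral_cexp_neg_mul_sq_norm_add (V := E) (b := 1 / 4) (by norm_num)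
    Complex.I t
  rw [charFun_apply, charFun_apply (μ := _ • _), integral_smul_measure,
    ← charFun_apply (μ := Measure.map _ _),
    charFun_map_sub_prod_stdGaussian, ENNReal.toReal_ofReal hd,
    integral_withDensity_eq_integral_toReal_smul (by fun_prop) (by simp)]
  have hdC : (d : ℂ) = (Real.pi / (1 / 4) : ℂ) ^ (Module.finrank ℝ E / 2 : ℂ) := by
    simp only [d]
    rw [Complex.ofReal_cpow (by positivity)]
    push_cast; rfl
  rw [Complex.real_smul, hdC]
  convert e1 using 1
  · congr 1 with p
    rw [ENNReal.toReal_ofReal (Real.exp_pos _).le, Complex.real_smul, Complex.ofReal_exp,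
      ← Complex.exp_add, real_inner_comm]
    congr 1
    push_cast
    ring
  · congr 2
    rw [Complex.I_sq]
    ring

lemma IsPosDefFun.integral_mul_gaussian_nonneg {φ : E → ℂ} (h : IsPosDefFun φ) (hc : Continuous φ)
    (h0 : 0 ≤ φ 0) {C : ℝ} (hb : ∀ p, ‖φ p‖ ≤ C) :
    0 ≤ ∫ p, (Real.exp (-‖p‖ ^ 2 / 4) : ℂ) * φ p := by
  obtain ⟨D, hD, hD'⟩ := exists_withDensity_gaussian_eq (E := E)
  have e : ∫ p, (Real.exp (-‖p‖ ^ 2 / 4) : ℂ) * φ p = ∫ p, φ p ∂((volume : Measure E).withDensity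
      (fun p => ENNReal.ofReal (Real.exp (-‖p‖ ^ 2 / 4)))) := by
    rw [integral_withDensity_eq_integral_toReal_smul (by fun_prop) (by simp)]
    congr 1 with p
    rw [ENNReal.toReal_ofReal (Real.exp_pos _).le, Complex.real_smul]
  rw [e, hD', integral_smul_measure, integral_map (by fun_prop) hc.aestronglyMeasurable]
  exact smul_nonneg ENNReal.toReal_nonneg (h.integral_prod_nonneg hc h0 hb _)

/-- Finite measures whose characteristic functions converge to a function that is continuous at `0`
have a limit with this characteristic function. -/
lemma exists_charFun_eq_of_tendsto {μ : ℕ → Measure E} [∀ n, IsFiniteMeasure (μ n)] {f : E → ℂ}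
    (hf : ContinuousAt f 0) (f0 : f 0 = 1)
    (h : ∀ t, Tendsto (fun n => charFun (μ n) t) atTop (𝓝 (f t))) :
    ∃ ν : Measure E, IsProbabilityMeasure ν ∧ ∀ t, charFun ν t = f t := by
  let F : ℕ → FiniteMeasure E := fun n => ⟨μ n, inferInstance⟩
  let P : ℕ → ProbabilityMeasure E := fun n =>
    FiniteMeasure.normalize (F n)
  have hmass : Tendsto (fun n => (((μ n).real Set.univ : ℝ) : ℂ)) atTop (𝓝 1) := by
    simpa [f0] using h 0
  have hP : ∀ t, Tendsto (fun n => charFun (P n : Measure E) t) atTop (𝓝 (f t)) := by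
    intro t
    have h1 : Tendsto (fun n => (((μ n).real Set.univ : ℝ) : ℂ)⁻¹ * charFun (μ n) t) atTop
        (𝓝 (1⁻¹ * f t)) := (hmass.inv₀ one_ne_zero).mul (h t)
    rw [inv_one, one_mul] at h1
    refine h1.congr' ?_
    -- Normalisation has its intended meaning only for nonzero measures, and the masses tend to `1`.
    filter_upwards [hmass.eventually_ne one_ne_zero] with n hn
    have hn' : F n ≠ 0 := by
      intro h0
      apply hn
      have : μ n = 0 := congrArg Subtype.val h0
      simp [this]
    rw [charFun_apply (μ := (P n : Measure E)),
      FiniteMeasure.toMeasure_normalize_eq_of_nonzero _ hn',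
      integral_smul_nnreal_measure, charFun_apply, NNReal.smul_def, Complex.real_smul]
    rw [NNReal.coe_inv, Complex.ofReal_inv]
    rfl
  have htight := isTightMeasureSet_of_tendsto_charFun hf hP
  have hcomp : IsCompact (closure (Set.range P)) :=
    isCompact_closure_of_isTightMeasureSet (by
      convert htight using 1
      ext m
      simp)
  -- Tightness gives relative compactness, hence a limit along an ultrafilter; it has the right
  -- characteristic function because the full sequence of characteristic functions converges.
  obtain ⟨ν, -, hν⟩ := hcomp.ultrafilter_le_nhds ((hyperfilter ℕ).map P)
    ((by simp : (↑((hyperfilter ℕ).map P) : Filter (ProbabilityMeasure E)) ≤ 𝓟 (Set.range P)).trans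
      (monotone_principal subset_closure))
  refine ⟨ν, inferInstance, fun t => ?_⟩
  have hν' : Tendsto P (hyperfilter ℕ) (𝓝 ν) := hν
  rw [ProbabilityMeasure.tendsto_iff_forall_integral_rclike_tendsto ℂ] at hν'
  have h2 := hν' (BoundedContinuousFunction.innerProbChar t)
  simp_rw [← charFun_eq_integral_innerProbChar] at h2
  exact tendsto_nhds_unique h2 ((hP t).mono_left Nat.hyperfilter_le_atTop)

lemma integrable_gaussian_mul {φ : E → ℂ} (hc : Continuous φ) {C : ℝ} (hb : ∀ p, ‖φ p‖ ≤ C) :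
    Integrable fun p => (Real.exp (-‖p‖ ^ 2 / 4) : ℂ) * φ p :=
  integrable_exp_neg_norm_sq_div_four.ofReal.mul_bdd (c := C) hc.aestronglyMeasurable
    (Eventually.of_forall hb)

/-- Multiplication by a character preserves positive definiteness, so the value at `ξ` is again a
Gaussian integral of a positive definite function. -/
lemma IsPosDefFun.fourier_gaussian_nonneg {φ : E → ℂ} (h : IsPosDefFun φ) (hc : Continuous φ)
    (h0 : 0 ≤ φ 0) {C : ℝ} (hb : ∀ p, ‖φ p‖ ≤ C) (ξ : E) :
    0 ≤ 𝓕 (fun p => (Real.exp (-‖p‖ ^ 2 / 4) : ℂ) * φ p) ξ := by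
  have := (h.mul_char (-(2 * Real.pi) • ξ)).integral_mul_gaussian_nonneg (by fun_prop)
    (by simpa using h0) (C := C) (fun p => by
      rw [norm_mul, mul_comm Complex.I, Complex.norm_exp_ofReal_mul_I, mul_one]; exact hb p)
  rw [Real.fourier_eq']
  refine this.trans_eq (integral_congr_ae (Eventually.of_forall fun p => ?_))
  simp only
  rw [smul_eq_mul, real_inner_smul_right]
  push_cast
  ring_nf

/-- The smoothed function `φ(p) e^{-|p|²/4}` is a characteristic function. -/
lemma IsPosDefFun.exists_charFun_eq_mul_gaussian {φ : E → ℂ} (h : IsPosDefFun φ)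
    (hc : Continuous φ) (h0 : φ 0 = 1) {C : ℝ} (hb : ∀ p, ‖φ p‖ ≤ C) :
    ∃ ν : Measure E, IsProbabilityMeasure ν ∧
      ∀ t, charFun ν t = (Real.exp (-‖t‖ ^ 2 / 4) : ℂ) * φ t := by
  set f : E → ℂ := fun p => (Real.exp (-‖p‖ ^ 2 / 4) : ℂ) * φ p with hf
  have hfi : Integrable f := integrable_gaussian_mul hc hb
  have hfc : Continuous f := by fun_prop
  have hpos : ∀ ξ, 0 ≤ 𝓕 f ξ := fun ξ =>
    h.fourier_gaussian_nonneg hc (by rw [h0]; exact zero_le_one) hb ξ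
  have hFc : Continuous (𝓕 f) := VectorFourier.fourierIntegral_continuous
    Real.continuous_fourierChar (by exact continuous_inner) hfi
  have hre : ∀ ξ, (((𝓕 f ξ).re : ℝ) : ℂ) = 𝓕 f ξ := fun ξ =>
    Complex.ext (by simp) (by simpa using (Complex.le_def.1 (hpos ξ)).2)
  have J : ∀ (n : ℕ) (v : E), Integrable (fun w : E =>
      Complex.exp (-((n + 1 : ℝ) : ℂ)⁻¹ * ‖w‖ ^ 2 + 2 * Real.pi * Complex.I * ⟪v, w⟫_ℝ)) :=
    fun n v => GaussianFourier.integrable_cexp_neg_mul_sq_norm_add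
      (by rw [← Complex.ofReal_inv, Complex.ofReal_re]; positivity) _ _
  -- Integrability of `𝓕 f` is not known yet, so it is damped by wide Gaussians. On the Fourier side
  -- this convolves `f` with an approximate identity.
  let dens : ℕ → E → ℝ := fun n ξ => Real.exp (-(n + 1 : ℝ)⁻¹ * ‖ξ‖ ^ 2) * (𝓕 f ξ).re
  have hdens0 : ∀ n ξ, 0 ≤ dens n ξ := fun n ξ =>
    mul_nonneg (Real.exp_pos _).le (Complex.le_def.1 (hpos ξ)).1
  have hdensc : ∀ n, Continuous (dens n) := fun n => by fun_prop
  have hdensi : ∀ n, Integrable (dens n) := by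
    intro n
    refine Integrable.mul_bdd (c := ∫ p, ‖f p‖)
      (f := fun ξ : E => Real.exp (-(n + 1 : ℝ)⁻¹ * ‖ξ‖ ^ 2))
      ?_ (by fun_prop) (Eventually.of_forall fun ξ =>
      (Complex.abs_re_le_norm _).trans (VectorFourier.norm_fourierIntegral_le_integral_norm _ _ _ _ _))
    convert (J n 0).re using 2 with w
    have : (-((n + 1 : ℝ) : ℂ)⁻¹ * ‖w‖ ^ 2 + 2 * Real.pi * Complex.I * ⟪(0 : E), w⟫_ℝ) =
        ((-(n + 1 : ℝ)⁻¹ * ‖w‖ ^ 2 : ℝ) : ℂ) := by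
      simp
    rw [this, ← Complex.ofReal_exp]
    rfl
  let μ : ℕ → Measure E := fun n => volume.withDensity fun ξ => ENNReal.ofReal (dens n ξ)
  have : ∀ n, IsFiniteMeasure (μ n) := fun n => isFiniteMeasure_withDensity_ofReal (hdensi n).2
  have hchar : ∀ n (v : E), charFun (μ n) ((2 * Real.pi) • v) =
      ∫ w, ((Real.pi * ((n + 1 : ℝ) : ℂ)) ^ (Module.finrank ℝ E / 2 : ℂ) *
        Complex.exp (-Real.pi ^ 2 * ((n + 1 : ℝ) : ℂ) * ‖v - w‖ ^ 2)) • f w := by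
    intro n v
    have hc0 : (0 : ℝ) < n + 1 := by positivity
    have e1 : charFun (μ n) ((2 * Real.pi) • v) = ∫ w : E,
        Complex.exp (-((n + 1 : ℝ) : ℂ)⁻¹ * ‖w‖ ^ 2 + 2 * Real.pi * Complex.I * ⟪v, w⟫_ℝ) •
          𝓕 f w := by
      rw [charFun_apply, integral_withDensity_eq_integral_toReal_smul
        ((hdensc n).measurable.ennreal_ofReal) (by simp)]
      congr 1 with w
      rw [ENNReal.toReal_ofReal (hdens0 n w), Complex.real_smul, smul_eq_mul, Complex.ofReal_mul,
        hre, mul_right_comm, Complex.ofReal_exp, ← Complex.exp_add, real_inner_smul_right,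
        real_inner_comm]
      congr 2
      push_cast
      ring
    rw [e1]
    have e2 := (VectorFourier.integral_fourierIntegral_smul_eq_flip (L := innerₗ E)
      Real.continuous_fourierChar continuous_inner (J n v) hfi).symm
    rw [flip_innerₗ] at e2
    refine Eq.trans e2 ?_
    congr 1 with w
    have := fourier_gaussian_innerProductSpace' (V := E) (b := ((n + 1 : ℝ) : ℂ)⁻¹)
      (by rw [← Complex.ofReal_inv, Complex.ofReal_re]; positivity) v w
    refine congrArg (· • f w) (Eq.trans this ?_)
    congr
    · simp
    · simp; ring
  obtain ⟨ν, hν, hν'⟩ := exists_charFun_eq_of_tendsto (μ := μ) (f := fun t => f ((2 * Real.pi)⁻¹ • t))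
    (by fun_prop) (by simp [hf, h0]) (fun t => by
      have hlim := (Real.tendsto_integral_gaussian_smul' hfi
        (hfc.continuousAt (x := (2 * Real.pi)⁻¹ • t))).comp
          (tendsto_atTop_add_const_right atTop 1 tendsto_natCast_atTop_atTop)
      refine hlim.congr fun n => ?_
      have := hchar n ((2 * Real.pi)⁻¹ • t)
      rw [smul_inv_smul₀ (by positivity)] at this
      rw [this]
      rfl)
  -- The factor `2π` converts between the conventions of `𝓕` and `charFun`.
  refine ⟨ν.map ((2 * Real.pi) • ·), Measure.isProbabilityMeasure_map (by fun_prop), fun t => ?_⟩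
  rw [charFun_map_smul, hν', inv_smul_smul₀ (by positivity)]

lemma IsPosDefFun.comp_smul {E : Type*} [AddCommGroup E] [Module ℝ E] {φ : E → ℂ}
    (h : IsPosDefFun φ) (a : ℝ) :
    IsPosDefFun fun p => φ (a • p) := by
  intro n x
  simpa [smul_sub] using h n fun j => a • x j

/-- **Bochner's theorem** for a finite dimensional inner product space. -/
theorem IsPosDefFun.exists_charFun_eq {φ : E → ℂ} (h : IsPosDefFun φ)
    (hc : Continuous φ) (h0 : φ 0 = 1) {C : ℝ} (hb : ∀ p, ‖φ p‖ ≤ C) :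
    ∃ ν : Measure E, IsProbabilityMeasure ν ∧ ∀ t, charFun ν t = φ t := by
  -- Stretching `φ` before smoothing and shrinking the measure afterwards leaves `φ` intact and
  -- widens the Gaussian factor, which tends to `1`.
  have hex : ∀ n : ℕ, ∃ ν : Measure E, IsProbabilityMeasure ν ∧
      ∀ t, charFun ν t = (Real.exp (-‖t‖ ^ 2 / 4) : ℂ) * φ (((n : ℝ) + 1) • t) := fun n =>
    (h.comp_smul ((n : ℝ) + 1)).exists_charFun_eq_mul_gaussian (by fun_prop) (by simpa using h0)
      fun p => hb _
  choose μ hμ hμ' using hex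
  have : ∀ n, IsFiniteMeasure ((μ n).map (((n : ℝ) + 1)⁻¹ • ·)) := fun n => inferInstance
  refine exists_charFun_eq_of_tendsto (μ := fun n => (μ n).map (((n : ℝ) + 1)⁻¹ • ·))
    hc.continuousAt h0 fun t => ?_
  have e : ∀ n : ℕ, charFun ((μ n).map (((n : ℝ) + 1)⁻¹ • ·)) t =
      (Real.exp (-‖((n : ℝ) + 1)⁻¹ • t‖ ^ 2 / 4) : ℂ) * φ t := by
    intro n
    rw [charFun_map_smul, hμ', smul_inv_smul₀ (by positivity)]
  simp_rw [e]
  have h1 : Tendsto (fun n : ℕ => ((n : ℝ) + 1)⁻¹) atTop (𝓝 0) := by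
    simpa using tendsto_one_div_add_atTop_nhds_zero_nat (𝕜 := ℝ)
  have hcont : Continuous fun s : ℝ => (Real.exp (-‖s • t‖ ^ 2 / 4) : ℂ) * φ t := by fun_prop
  have := (hcont.tendsto 0).comp h1
  rw [zero_smul, norm_zero, zero_pow two_ne_zero, neg_zero, zero_div, Real.exp_zero,
    Complex.ofReal_one, one_mul] at this
  exact this

end Bochner

/-! ### Weyl operators: commutation relations and weak continuity. -/

section Weyl

open Filter Topology

variable {N : ℕ}

lemma coeFn_weyl (x : Phase N) (ψ : ModeSpace N) : weyl x ψ =ᵐ[volume] weylFun x ψ :=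
  MemLp.coeFn_toLp (memLp_weylFun x (Lp.memLp ψ))

lemma norm_weyl_apply (x : Phase N) (ψ : ModeSpace N) : ‖weyl x ψ‖ = ‖ψ‖ := by
  rw [weyl, LinearIsometry.coe_toContinuousLinearMap, LinearIsometry.norm_map]

lemma inner_weyl_weyl (x : Phase N) (φ ψ : ModeSpace N) : ⟪weyl x φ, weyl x ψ⟫_ℂ = ⟪φ, ψ⟫_ℂ := by
  rw [weyl, LinearIsometry.coe_toContinuousLinearMap, LinearIsometry.inner_map_map]

lemma dotProduct_Omega_mulVec (x y : Phase N) :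
    x ⬝ᵥ Omega N *ᵥ y = posPart x ⬝ᵥ momPart y - momPart x ⬝ᵥ posPart y := by
  simp only [dotProduct, mulVec, Omega, posPart, momPart, Fintype.sum_prod_type, Fin.sum_univ_two,
    blockDiagonal_apply]
  simp [Finset.sum_ite_eq, sub_eq_add_neg]

/-- The canonical commutation relations in Weyl form. -/
lemma weyl_weyl (x y : Phase N) (ψ : ModeSpace N) :
    weyl x (weyl y ψ) =
      Complex.exp (-Complex.I * ((x ⬝ᵥ Omega N *ᵥ y : ℝ) : ℂ) / 2) • weyl (x + y) ψ := by
  refine Lp.ext ?_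
  have h1 := (coeFn_weyl x (weyl y ψ)).trans (weylFun_congr x (coeFn_weyl y ψ))
  have h2 := Lp.coeFn_smul (Complex.exp (-Complex.I * ((x ⬝ᵥ Omega N *ᵥ y : ℝ) : ℂ) / 2))
    (weyl (x + y) ψ)
  filter_upwards [h1, h2, coeFn_weyl (x + y) ψ] with t h1 h2 h3
  rw [h1, h2, Pi.smul_apply, h3]
  have hp : posPart (x + y) = posPart x + posPart y := rfl
  have hm : momPart (x + y) = momPart x + momPart y := rfl
  simp only [weylFun, smul_eq_mul]
  rw [← mul_assoc, ← mul_assoc, ← Complex.exp_add, ← Complex.exp_add, hp, hm, sub_sub,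
    dotProduct_Omega_mulVec]
  congr 2
  simp only [add_dotProduct, dotProduct_add, dotProduct_sub]
  rw [dotProduct_comm (posPart x) (momPart y)]
  push_cast
  ring

lemma weyl_zero (ψ : ModeSpace N) : weyl (0 : Phase N) ψ = ψ := by
  refine Lp.ext ((coeFn_weyl 0 ψ).trans (Eventually.of_forall fun t => ?_))
  have hp : posPart (0 : Phase N) = 0 := rfl
  have hm : momPart (0 : Phase N) = 0 := rfl
  simp [weylFun, hp, hm]

/-- Exhibits the expectation at a difference as a Gram matrix entry twisted by a symplectic phase,
the form needed for positive definiteness. -/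
lemma inner_weyl_sub (x y : Phase N) (ψ : ModeSpace N) :
    ⟪ψ, weyl (y - x) ψ⟫_ℂ =
      Complex.exp (-Complex.I * ((x ⬝ᵥ Omega N *ᵥ y : ℝ) : ℂ) / 2) * ⟪weyl x ψ, weyl y ψ⟫_ℂ := by
  have hxx : x ⬝ᵥ Omega N *ᵥ x = 0 := by
    rw [dotProduct_Omega_mulVec, dotProduct_comm, sub_self]
  have h := weyl_weyl x (y - x) ψ
  rw [add_sub_cancel, mulVec_sub, dotProduct_sub, hxx, sub_zero] at h
  rw [← inner_weyl_weyl x, h, inner_smul_right]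

lemma continuous_weyl_position (ψ : ModeSpace N) :
    Continuous fun q : Fin N → ℝ => weyl (fun i => if i.1 = 0 then q i.2 else 0) ψ := by
  let g : (Fin N → ℝ) → C(Fin N → ℝ, Fin N → ℝ) :=
    ContinuousMap.curry ⟨fun z : (Fin N → ℝ) × (Fin N → ℝ) => z.2 - z.1, by fun_prop⟩
  have hg : Continuous g := ContinuousMap.continuous _
  have hmp : ∀ q, MeasurePreserving (g q) volume volume := fun q =>
    measurePreserving_sub_right volume q
  have h := (continuous_const (y := ψ) (X := Fin N → ℝ)).compMeasurePreservingLp hg hmp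
    (by norm_num : (2 : ENNReal) ≠ ∞)
  refine h.congr fun q => Lp.ext ?_
  refine (Lp.coeFn_compMeasurePreserving ψ (hmp q)).trans ((coeFn_weyl _ ψ).trans
    (Eventually.of_forall fun t => ?_)).symm
  have hp : posPart (fun i : PhaseIdx N => if i.1 = 0 then q i.2 else 0) = q := by
    ext j; simp [posPart]
  have hm : momPart (fun i : PhaseIdx N => if i.1 = 0 then q i.2 else 0) = 0 := by
    ext j; simp [momPart]
  simp [weylFun, hp, hm, g]

lemma continuous_inner_weyl_momentum (φ ψ : ModeSpace N) :
    Continuous fun p : Fin N → ℝ => ⟪φ, weyl (fun i => if i.1 = 0 then 0 else p i.2) ψ⟫_ℂ := by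
  have e : ∀ p : Fin N → ℝ, ⟪φ, weyl (fun i => if i.1 = 0 then 0 else p i.2) ψ⟫_ℂ =
      ∫ t, Complex.exp (Complex.I * ((p ⬝ᵥ t : ℝ) : ℂ)) * ⟪φ t, ψ t⟫_ℂ := by
    intro p
    rw [L2.inner_def]
    refine integral_congr_ae ?_
    filter_upwards [coeFn_weyl (fun i : PhaseIdx N => if i.1 = 0 then 0 else p i.2) ψ] with t ht
    have hp : posPart (fun i : PhaseIdx N => if i.1 = 0 then 0 else p i.2) = 0 := by
      ext j; simp [posPart]
    have hm : momPart (fun i : PhaseIdx N => if i.1 = 0 then 0 else p i.2) = p := by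
      ext j; simp [momPart]
    rw [ht, weylFun, hp, hm, dotProduct_zero, zero_div, sub_zero, sub_zero, ← smul_eq_mul,
      inner_smul_right]
  simp_rw [e]
  have hi : Integrable (fun t => ⟪φ t, ψ t⟫_ℂ) volume := L2.integrable_inner φ ψ
  refine continuous_of_dominated (bound := fun t => ‖⟪φ t, ψ t⟫_ℂ‖) (fun p => ?_) (fun p => ?_)
    hi.norm (Eventually.of_forall fun t => ?_)
  · refine AEStronglyMeasurable.mul (Continuous.aestronglyMeasurable ?_) hi.1
    unfold dotProduct
    fun_prop
  · refine Eventually.of_forall fun t => ?_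
    rw [norm_mul, mul_comm Complex.I, Complex.norm_exp_ofReal_mul_I, one_mul]
  · unfold dotProduct
    fun_prop

/-- The Weyl operators are weakly continuous. -/
lemma continuous_inner_weyl (φ ψ : ModeSpace N) : Continuous fun x : Phase N => ⟪φ, weyl x ψ⟫_ℂ := by
  let P : Phase N → Phase N := fun x i => if i.1 = 0 then 0 else momPart x i.2
  let Q : Phase N → Phase N := fun x i => if i.1 = 0 then posPart x i.2 else 0
  have hpos : Continuous (posPart : Phase N → _) := by unfold posPart; fun_prop
  have hmom : Continuous (momPart : Phase N → _) := by unfold momPart; fun_prop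
  have hQ : Continuous fun x => weyl (Q x) ψ := (continuous_weyl_position ψ).comp hpos
  have hP : ∀ χ, Continuous fun x => ⟪φ, weyl (P x) χ⟫_ℂ := fun χ =>
    (continuous_inner_weyl_momentum φ χ).comp hmom
  -- Strong continuity of translations combines with weak continuity of multiplications because the
  -- latter are isometric.
  have hPQ : Continuous fun x => ⟪φ, weyl (P x) (weyl (Q x) ψ)⟫_ℂ := by
    refine continuous_iff_continuousAt.2 fun y => ?_
    have h1 : Tendsto (fun x => ⟪φ, weyl (P x) (weyl (Q x) ψ - weyl (Q y) ψ)⟫_ℂ) (𝓝 y) (𝓝 0) := by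
      refine squeeze_zero_norm (a := fun x => ‖φ‖ * ‖weyl (Q x) ψ - weyl (Q y) ψ‖) (fun x => ?_) ?_
      · refine (norm_inner_le_norm _ _).trans ?_
        rw [norm_weyl_apply]
      · have : Continuous fun x => ‖φ‖ * ‖weyl (Q x) ψ - weyl (Q y) ψ‖ := by fun_prop
        simpa using this.tendsto y
    have h2 := h1.add ((hP (weyl (Q y) ψ)).tendsto y)
    rw [zero_add] at h2
    refine h2.congr fun x => ?_
    rw [map_sub, inner_sub_right, sub_add_cancel]
  have e : ∀ x, ⟪φ, weyl x ψ⟫_ℂ =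
      Complex.exp (Complex.I * ((P x ⬝ᵥ Omega N *ᵥ Q x : ℝ) : ℂ) / 2) *
        ⟪φ, weyl (P x) (weyl (Q x) ψ)⟫_ℂ := by
    intro x
    have hx : P x + Q x = x := by
      ext ⟨i, j⟩
      fin_cases i <;> simp [P, Q, posPart, momPart]
    rw [weyl_weyl, hx, inner_smul_right, ← mul_assoc, ← Complex.exp_add]
    simp [neg_div]
  simp_rw [e]
  refine Continuous.mul ?_ hPQ
  have hPc : Continuous P := continuous_pi fun i => by
    by_cases h : i.1 = 0
    · simp only [P, h, if_true]; fun_prop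
    · simp only [P, h, if_false]; fun_prop
  have hQc : Continuous Q := continuous_pi fun i => by
    by_cases h : i.1 = 0
    · simp only [Q, h, if_true]; fun_prop
    · simp only [Q, h, if_false]; fun_prop
  have : Continuous fun x => P x ⬝ᵥ Omega N *ᵥ Q x :=
    hPc.dotProduct (continuous_const.matrix_mulVec hQc)
  fun_prop

lemma exists_modeSpace_norm_pos (N : ℕ) : ∃ ψ : ModeSpace N, 0 < ‖ψ‖ := by
  have hfin : (volume : Measure (Fin N → ℝ)) (Metric.ball 0 1) ≠ ∞ := measure_ball_lt_top.ne
  refine ⟨indicatorConstLp 2 measurableSet_ball hfin (1 : ℂ), ?_⟩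
  rw [norm_indicatorConstLp (by norm_num) (by norm_num), norm_one, one_mul]
  exact Real.rpow_pos_of_pos (ENNReal.toReal_pos (Metric.measure_ball_pos _ _ one_pos).ne' hfin) _

end Weyl

/-! ### Entrywise exponentials of positive semidefinite matrices. -/

section PosDef

open Filter Topology

/-- Entrywise powers are positive by the Schur product theorem, and the exponential series has
nonnegative coefficients. -/
lemma posSemidef_map_exp {ι : Type*} [Fintype ι] {A : Matrix ι ι ℂ} (hA : A.PosSemidef) :
    (A.map Complex.exp).PosSemidef := by
  have hpow : ∀ n : ℕ, (A.map (· ^ n)).PosSemidef := by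
    intro n
    induction n with
    | zero =>
      have := Matrix.posSemidef_vecMulVec_star_self (fun _ : ι => (1 : ℂ))
      refine (congrArg Matrix.PosSemidef (Matrix.ext fun j k => ?_)).mpr this
      simp [vecMulVec_apply]
    | succ n ih =>
      refine (congrArg Matrix.PosSemidef (Matrix.ext fun j k => ?_)).mpr (ih.hadamard hA)
      simp [pow_succ]
  rw [Matrix.posSemidef_iff_dotProduct_mulVec]
  refine ⟨?_, fun v => ?_⟩
  · ext j k
    have := hA.isHermitian.apply j k
    rw [conjTranspose_apply, map_apply, map_apply, RCLike.star_def, ← Complex.exp_conj]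
    exact congrArg Complex.exp this
  · have hlim : Tendsto (fun m : ℕ => ∑ n ∈ Finset.range m,
        ((n.factorial : ℝ)⁻¹ : ℂ) * (star v ⬝ᵥ A.map (· ^ n) *ᵥ v)) atTop
        (𝓝 (star v ⬝ᵥ A.map Complex.exp *ᵥ v)) := by
      refine HasSum.tendsto_sum_nat ?_
      simp only [dotProduct, mulVec, Finset.mul_sum, map_apply]
      refine hasSum_sum fun j _ => hasSum_sum fun k _ => ?_
      have h := ((NormedSpace.expSeries_div_hasSum_exp (A j k)).mul_right (v k)).mul_left (star v j)
      rw [← Complex.exp_eq_exp_ℂ] at h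
      refine (congrArg (HasSum · _) (funext fun n => ?_)).mpr h
      push_cast
      ring
    refine ge_of_tendsto' hlim fun m => Finset.sum_nonneg fun n _ => mul_nonneg ?_
      ((Matrix.posSemidef_iff_dotProduct_mulVec.1 (hpow n)).2 v)
    rw [← Complex.ofReal_inv]
    exact Complex.zero_le_real.2 (by positivity)

lemma isSymm_of_posSemidef_sub {ι : Type*} {L S : Matrix ι ι ℝ}
    (h : (L.map Complex.ofReal - Complex.I • S.map Complex.ofReal).PosSemidef) : L.IsSymm := by
  ext i j
  have := congrArg Complex.re (h.isHermitian.apply i j)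
  simpa using this

end PosDef

/-! ### Positive definiteness of Gaussian characteristic functions. -/

section GaussianPosDef

variable {N M : ℕ} {K : Matrix (PhaseIdx N) (Fin M) ℝ} {L : Matrix (Fin M) (Fin M) ℝ}

lemma ofReal_dotProduct_mulVec {m n : Type*} [Fintype m] [Fintype n] (A : Matrix m n ℝ) (x : m → ℝ)
    (y : n → ℝ) : ((x ⬝ᵥ A *ᵥ y : ℝ) : ℂ) =
      (fun i => (x i : ℂ)) ⬝ᵥ A.map Complex.ofReal *ᵥ fun i => (y i : ℂ) := by
  simp [dotProduct, mulVec]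

lemma dotProduct_conj_mulVec {m n : Type*} [Fintype m] [Fintype n] (K : Matrix m n ℝ)
    (Z : Matrix m m ℝ) (x y : n → ℝ) :
    x ⬝ᵥ (Kᵀ * Z * K) *ᵥ y = (K *ᵥ x) ⬝ᵥ Z *ᵥ (K *ᵥ y) := by
  rw [← mulVec_mulVec, ← mulVec_mulVec, dotProduct_mulVec x, vecMul_transpose]

lemma dotProduct_mulVec_nonneg_of_posSemidef_sub {S : Matrix (Fin M) (Fin M) ℝ}
    (h : (L.map Complex.ofReal - Complex.I • S.map Complex.ofReal).PosSemidef) (p : Fin M → ℝ) :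
    0 ≤ p ⬝ᵥ L *ᵥ p := by
  have h1 := (Matrix.posSemidef_iff_dotProduct_mulVec.1 h).2 fun i => (p i : ℂ)
  have hs : star (fun i => (p i : ℂ)) = fun i => (p i : ℂ) := by ext; simp
  rw [hs, sub_mulVec, smul_mulVec, dotProduct_sub, dotProduct_smul, ← ofReal_dotProduct_mulVec,
    ← ofReal_dotProduct_mulVec] at h1
  simpa using (Complex.le_def.1 h1).1

/-- The matrix elements of `e^{-pᵀLp/4 - i mᵀp} W(Kp)` are positive definite functions. -/
lemma isPosDefFun_gaussian_weyl
    (h : (L.map Complex.ofReal - Complex.I • (Kᵀ * Omega N * K).map Complex.ofReal).PosSemidef)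
    (m : Fin M → ℝ) (ψ : ModeSpace N) :
    IsPosDefFun fun p : Fin M → ℝ =>
      Complex.exp (-((p ⬝ᵥ L *ᵥ p : ℝ) : ℂ) / 4 - Complex.I * ((m ⬝ᵥ p : ℝ) : ℂ)) *
        ⟪ψ, weyl (K *ᵥ p) ψ⟫_ℂ := by
  intro n x
  -- The matrix is the Hadamard product of a rank one matrix (terms in `xⱼ` or `xₖ` alone), the
  -- entrywise exponential of `T = ½ Pᴴ(L - iKᵀΩK)P` (cross terms and symplectic phase), and the
  -- Gram matrix of the vectors `W(Kxₖ)ψ`.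
  let a : Fin n → ℂ := fun k =>
    Complex.exp (-((x k ⬝ᵥ L *ᵥ x k : ℝ) : ℂ) / 4 - Complex.I * ((m ⬝ᵥ x k : ℝ) : ℂ))
  let P : Matrix (Fin M) (Fin n) ℂ := Matrix.of fun i k => (x k i : ℂ)
  let T : Matrix (Fin n) (Fin n) ℂ := (1 / 2 : ℝ) • (Pᴴ * (L.map Complex.ofReal -
    Complex.I • (Kᵀ * Omega N * K).map Complex.ofReal) * P)
  have hT : T.PosSemidef := (h.conjTranspose_mul_mul_same P).smul (by norm_num)
  have hTe : ∀ j k, T j k = (((x j ⬝ᵥ L *ᵥ x k : ℝ) : ℂ) -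
      Complex.I * (((K *ᵥ x j) ⬝ᵥ Omega N *ᵥ (K *ᵥ x k) : ℝ) : ℂ)) / 2 := by
    intro j k
    have e : (Pᴴ * (L.map Complex.ofReal -
        Complex.I • (Kᵀ * Omega N * K).map Complex.ofReal) * P) j k =
        ((x j ⬝ᵥ L *ᵥ x k : ℝ) : ℂ) -
          Complex.I * (((K *ᵥ x j) ⬝ᵥ Omega N *ᵥ (K *ᵥ x k) : ℝ) : ℂ) := by
      have e0 : ∀ Z : Matrix (Fin M) (Fin M) ℂ, (Pᴴ * Z * P) j k =
          (fun i => (x j i : ℂ)) ⬝ᵥ Z *ᵥ fun i => (x k i : ℂ) := fun Z => by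
        rw [Matrix.mul_assoc]
        simp [Matrix.mul_apply, dotProduct, mulVec, P]
      rw [e0, sub_mulVec, smul_mulVec, dotProduct_sub, dotProduct_smul,
        ← ofReal_dotProduct_mulVec, ← ofReal_dotProduct_mulVec, dotProduct_conj_mulVec, smul_eq_mul]
    simp only [T]
    rw [Matrix.smul_apply, e, Complex.real_smul]
    push_cast
    ring
  have hG : (Matrix.gram ℂ fun k => weyl (K *ᵥ x k) ψ).PosSemidef := Matrix.posSemidef_gram ℂ _
  have hall := ((Matrix.posSemidef_vecMulVec_star_self a).hadamard
    (posSemidef_map_exp hT)).hadamard hG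
  refine (congrArg Matrix.PosSemidef (Matrix.ext fun j k => ?_)).mpr hall
  have hL : x k ⬝ᵥ L *ᵥ x j = x j ⬝ᵥ L *ᵥ x k := by
    rw [dotProduct_mulVec, ← mulVec_transpose, (isSymm_of_posSemidef_sub h).eq, dotProduct_comm]
  simp only [of_apply, hadamard_apply, vecMulVec_apply, Pi.star_apply, RCLike.star_def, map_apply,
    Matrix.gram_apply, hTe]
  rw [mulVec_sub K, inner_weyl_sub, ← mul_assoc]
  congr 1
  simp only [a]
  rw [← Complex.exp_conj, ← Complex.exp_add, ← Complex.exp_add, ← Complex.exp_add, mulVec_sub,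
    dotProduct_sub, dotProduct_sub, sub_dotProduct, sub_dotProduct, hL]
  congr 1
  simp only [map_sub, map_mul, map_div₀, map_neg, Complex.conj_I, Complex.conj_ofReal]
  have h4 : (starRingEnd ℂ) 4 = 4 := Complex.conj_ofNat 4
  rw [h4]
  push_cast
  ring

end GaussianPosDef

/-! ### Fourier transforms of finite measures on `ℝᴹ`. -/

section Fourier

variable {M : ℕ}

lemma charFun_map_toLp (μ : Measure (Fin M → ℝ)) (t : EuclideanSpace ℝ (Fin M)) :
    charFun (μ.map (WithLp.toLp 2)) t =
      ∫ x, Complex.exp (Complex.I * ((t.ofLp ⬝ᵥ x : ℝ) : ℂ)) ∂μ := by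
  rw [charFun_apply, integral_map (by fun_prop) (Continuous.aestronglyMeasurable (by fun_prop))]
  congr 1 with x
  congr 1
  rw [mul_comm, EuclideanSpace.inner_eq_star_dotProduct]
  simp

lemma measure_ext_of_integral_exp {μ ν : Measure (Fin M → ℝ)} [IsFiniteMeasure μ] [IsFiniteMeasure ν]
    (h : ∀ p : Fin M → ℝ, ∫ x, Complex.exp (Complex.I * ((p ⬝ᵥ x : ℝ) : ℂ)) ∂μ =
      ∫ x, Complex.exp (Complex.I * ((p ⬝ᵥ x : ℝ) : ℂ)) ∂ν) : μ = ν := by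
  have h1 : μ.map (WithLp.toLp 2) = ν.map (WithLp.toLp 2) :=
    Measure.ext_of_charFun (E := EuclideanSpace ℝ (Fin M)) (funext fun t => by
      rw [charFun_map_toLp, charFun_map_toLp, h])
  have h2 := congrArg (Measure.map (WithLp.ofLp (p := 2))) h1
  rw [Measure.map_map (by fun_prop) (by fun_prop), Measure.map_map (by fun_prop) (by fun_prop)] at h2
  simpa [Function.comp_def] using h2

lemma integrable_exp_I_mul_dotProduct (μ : Measure (Fin M → ℝ)) [IsFiniteMeasure μ] (p : Fin M → ℝ) :
    Integrable (fun x => Complex.exp (Complex.I * ((p ⬝ᵥ x : ℝ) : ℂ))) μ := by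
  refine Integrable.of_bound (Continuous.aestronglyMeasurable ?_) 1
    (Filter.Eventually.of_forall fun x => ?_)
  · unfold dotProduct
    fun_prop
  · rw [mul_comm, Complex.norm_exp_ofReal_mul_I]

/-- **Bochner's theorem** on `ℝᴹ`. -/
lemma IsPosDefFun.exists_measure {φ : (Fin M → ℝ) → ℂ} (h : IsPosDefFun φ) (hc : Continuous φ)
    {c : ℝ} (hc0 : 0 ≤ c) (h0 : φ 0 = c) (hb : ∀ p, ‖φ p‖ ≤ c) :
    ∃ μ : Measure (Fin M → ℝ), IsFiniteMeasure μ ∧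
      ∀ p, ∫ x, Complex.exp (Complex.I * ((p ⬝ᵥ x : ℝ) : ℂ)) ∂μ = φ p := by
  rcases hc0.eq_or_lt with rfl | hcpos
  · refine ⟨0, inferInstance, fun p => ?_⟩
    rw [integral_zero_measure]
    exact (norm_le_zero_iff.1 (hb p)).symm
  · have hne : (c : ℂ) ≠ 0 := Complex.ofReal_ne_zero.2 hcpos.ne'
    have hpd : IsPosDefFun fun t : EuclideanSpace ℝ (Fin M) => c⁻¹ • φ t.ofLp := fun n x =>
      (h n fun k => (x k).ofLp).smul (inv_nonneg.2 hc0)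
    obtain ⟨ν, hν, hν'⟩ := hpd.exists_charFun_eq (C := 1) (by fun_prop)
      (by rw [WithLp.ofLp_zero, h0, Complex.real_smul, Complex.ofReal_inv, inv_mul_cancel₀ hne])
      (fun p => by
        rw [norm_smul, norm_inv, Real.norm_of_nonneg hc0, inv_mul_le_iff₀ hcpos, mul_one]
        exact hb _)
    refine ⟨c.toNNReal • ν.map (WithLp.ofLp (p := 2)), inferInstance, fun p => ?_⟩
    have e := charFun_map_toLp (ν.map (WithLp.ofLp (p := 2))) (WithLp.toLp 2 p)
    rw [Measure.map_map (by fun_prop) (by fun_prop)] at e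
    simp only [Function.comp_def, WithLp.toLp_ofLp, Measure.map_id', hν'] at e
    rw [integral_smul_nnreal_measure, ← e, NNReal.smul_def, Real.coe_toNNReal _ hc0, smul_smul,
      mul_inv_cancel₀ hcpos.ne', one_smul]

/-- Uniqueness of Fourier transforms for real combinations: the terms with positive and with
negative coefficients form two finite measures with the same transform. -/
lemma sum_mul_measureReal_eq_zero {ι : Type*} [Fintype ι] (μ : ι → Measure (Fin M → ℝ))
    [∀ i, IsFiniteMeasure (μ i)] (a : ι → ℝ)
    (h : ∀ p : Fin M → ℝ, ∑ i, (a i : ℂ) * ∫ x, Complex.exp (Complex.I * ((p ⬝ᵥ x : ℝ) : ℂ)) ∂μ i = 0)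
    (X : Set (Fin M → ℝ)) : ∑ i, a i * (μ i).real X = 0 := by
  let pos : Measure (Fin M → ℝ) := ∑ i, (a i).toNNReal • μ i
  let neg : Measure (Fin M → ℝ) := ∑ i, (-a i).toNNReal • μ i
  have hsplit : ∀ i, ((a i).toNNReal : ℝ) - ((-a i).toNNReal : ℝ) = a i := fun i => by
    rw [Real.coe_toNNReal', Real.coe_toNNReal']
    exact max_zero_sub_max_neg_zero_eq_self (a i)
  have hint : ∀ (b : ι → NNReal) (p : Fin M → ℝ),
      ∫ x, Complex.exp (Complex.I * ((p ⬝ᵥ x : ℝ) : ℂ)) ∂(∑ i, b i • μ i) =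
        ∑ i, ((b i : ℝ) : ℂ) * ∫ x, Complex.exp (Complex.I * ((p ⬝ᵥ x : ℝ) : ℂ)) ∂μ i := by
    intro b p
    rw [integral_finsetSum_measure fun i _ => integrable_exp_I_mul_dotProduct _ p]
    refine Finset.sum_congr rfl fun i _ => ?_
    rw [integral_smul_nnreal_measure, NNReal.smul_def, Complex.real_smul]
  have hreal : ∀ b : ι → NNReal, (∑ i, b i • μ i).real X = ∑ i, (b i : ℝ) * (μ i).real X := by
    intro b
    rw [measureReal_def, Measure.finsetSum_apply, ENNReal.toReal_sum fun i _ => measure_ne_top _ _]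
    exact Finset.sum_congr rfl fun i _ => measureReal_nnreal_smul_apply _
  have heq : pos = neg := by
    refine measure_ext_of_integral_exp fun p => ?_
    rw [hint, hint, ← sub_eq_zero, ← Finset.sum_sub_distrib, ← h p]
    refine Finset.sum_congr rfl fun i _ => ?_
    rw [← sub_mul, ← Complex.ofReal_sub, hsplit]
  have h1 : pos.real X = neg.real X := by rw [heq]
  rw [hreal, hreal, ← sub_eq_zero, ← Finset.sum_sub_distrib] at h1
  rw [← h1]
  refine Finset.sum_congr rfl fun i _ => ?_
  rw [← sub_mul, hsplit]

end Fourier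

/-! ### Operators from quadratic forms. -/

section QuadraticForm

variable {H : Type*} [NormedAddCommGroup H] [InnerProductSpace ℂ H] [CompleteSpace H]

/-- A bounded nonnegative function on a Hilbert space that satisfies all the linear relations
satisfied by the quadratic forms of operators is the quadratic form of an operator. -/
lemma exists_operator_of_quadratic (q : H → ℝ)
    (hq : ∀ (n : ℕ) (a : Fin n → ℝ) (v : Fin n → H),
      (∀ T : H →L[ℂ] H, ∑ i, (a i : ℂ) * ⟪v i, T (v i)⟫_ℂ = 0) → ∑ i, a i * q (v i) = 0)
    (h0 : ∀ v, 0 ≤ q v) (h1 : ∀ v, q v ≤ ‖v‖ ^ 2) :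
    ∃ T : H →L[ℂ] H, ∀ v, ⟪v, T v⟫_ℂ = q v := by
  -- The prospective `Re ⟨v, T w⟩`. Each identity for `r` is a linear relation among values of `q`
  -- that holds for every operator, so `hq` supplies it.
  let r : H → H → ℝ := fun v w => (q (v + w) - q (v - w)) / 4
  have r_add : ∀ v w₁ w₂, r v (w₁ + w₂) = r v w₁ + r v w₂ := by
    intro v w₁ w₂
    have := hq 6 ![1, -1, -1, 1, -1, 1]
      ![v + (w₁ + w₂), v - (w₁ + w₂), v + w₁, v - w₁, v + w₂, v - w₂] (fun T => by
        simp [Fin.sum_univ_succ]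
        ring)
    simp [Fin.sum_univ_succ] at this
    simp only [r]
    linarith
  have r_symm : ∀ v w, r v w = r w v := by
    intro v w
    have := hq 4 ![1, -1, -1, 1] ![v + w, v - w, w + v, w - v] (fun T => by
        simp [Fin.sum_univ_succ]
        ring)
    simp [Fin.sum_univ_succ] at this
    simp only [r]
    linarith
  have r_smul : ∀ (c : ℂ) v w, r v (c • w) = c.re * r v w + c.im * r v (Complex.I • w) := by
    intro c v w
    have := hq 6 ![1, -1, -c.re, c.re, -c.im, c.im]
      ![v + c • w, v - c • w, v + w, v - w, v + Complex.I • w, v - Complex.I • w] (fun T => by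
        obtain ⟨x, y⟩ := c
        have hc : (⟨x, y⟩ : ℂ) = x + y * Complex.I := Complex.mk_eq_add_mul_I x y
        rw [hc]
        simp [Fin.sum_univ_succ]
        ring)
    simp [Fin.sum_univ_succ] at this
    simp only [r]
    linarith
  have smul_r : ∀ (c : ℂ) v w, r (c • v) w = c.re * r v w - c.im * r v (Complex.I • w) := by
    intro c v w
    have := hq 6 ![1, -1, -c.re, c.re, c.im, -c.im]
      ![c • v + w, c • v - w, v + w, v - w, v + Complex.I • w, v - Complex.I • w] (fun T => by
        obtain ⟨x, y⟩ := c
        have hc : (⟨x, y⟩ : ℂ) = x + y * Complex.I := Complex.mk_eq_add_mul_I x y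
        rw [hc]
        simp [Fin.sum_univ_succ]
        ring)
    simp [Fin.sum_univ_succ] at this
    simp only [r]
    linarith
  have r_self : ∀ v, r v v = q v := by
    intro v
    have := hq 3 ![1, -1, -4] ![v + v, v - v, v] (fun T => by
        simp [Fin.sum_univ_succ]
        ring)
    simp [Fin.sum_univ_succ] at this
    simp only [r, sub_self]
    linarith
  have r_I : ∀ v, r v (Complex.I • v) = 0 := by
    intro v
    have := hq 2 ![1, -1] ![v + Complex.I • v, v - Complex.I • v] (fun T => by
        simp [Fin.sum_univ_succ]
        ring)
    simp [Fin.sum_univ_succ] at this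
    simp only [r]
    linarith
  have r_II : ∀ v w, r v (Complex.I • Complex.I • w) = -r v w := by
    intro v w
    rw [smul_smul, r_smul]
    simp
  have r_bound : ∀ v w, |r v w| ≤ ‖v‖ ^ 2 + ‖w‖ ^ 2 := by
    intro v w
    have hp := parallelogram_law_with_norm ℂ v w
    have a1 := h0 (v + w)
    have a2 := h0 (v - w)
    have a3 := h1 (v + w)
    have a4 := h1 (v - w)
    have : 0 ≤ ‖v‖ ^ 2 + ‖w‖ ^ 2 := by positivity
    simp only [r]
    rw [abs_le]
    constructor <;> nlinarith
  let b : H → H → ℂ := fun v w => r v w - Complex.I * r v (Complex.I • w)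
  let B : H →ₗ⋆[ℂ] H →ₗ[ℂ] ℂ := LinearMap.mk₂'ₛₗ (starRingEnd ℂ) (RingHom.id ℂ) b
    (fun v₁ v₂ w => by
      simp only [b]
      rw [r_symm (v₁ + v₂), r_symm (v₁ + v₂), r_add, r_add, r_symm w, r_symm w, r_symm _ v₁,
        r_symm _ v₂]
      push_cast
      ring)
    (fun c v w => by
      simp only [b]
      rw [smul_r, smul_r, r_II, smul_eq_mul]
      conv_rhs => rw [← Complex.re_add_im c]
      simp only [map_add, map_mul, Complex.conj_ofReal, Complex.conj_I]
      push_cast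
      linear_combination (-(c.im : ℂ) * r v (Complex.I • w)) * Complex.I_sq)
    (fun v w₁ w₂ => by
      simp only [b]
      rw [smul_add, r_add, r_add]
      push_cast
      ring)
    (fun c v w => by
      simp only [b, RingHom.id_apply]
      rw [smul_comm, r_smul c v w, r_smul c v (Complex.I • w), r_II, smul_eq_mul]
      conv_rhs => rw [← Complex.re_add_im c]
      push_cast
      linear_combination ((c.im : ℂ) * r v (Complex.I • w)) * Complex.I_sq)
  have b_bound : ∀ v w, ‖b v w‖ ≤ 2 * (‖v‖ ^ 2 + ‖w‖ ^ 2) := by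
    intro v w
    have a1 := r_bound v w
    have a2 := r_bound v (Complex.I • w)
    rw [norm_smul, Complex.norm_I, one_mul] at a2
    refine (norm_sub_le _ _).trans ?_
    rw [norm_mul, Complex.norm_I, one_mul, Complex.norm_real, Complex.norm_real, Real.norm_eq_abs,
      Real.norm_eq_abs]
    linarith
  -- On unit vectors the additive bound reads `2(1 + 1) = 4`; sesquilinearity then gives the general
  -- case.
  have B_bound : ∀ v w, ‖B v w‖ ≤ 4 * ‖v‖ * ‖w‖ := by
    intro v w
    by_cases hv : ‖v‖ = 0
    · rw [norm_eq_zero.1 hv]; simp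
    by_cases hw : ‖w‖ = 0
    · rw [norm_eq_zero.1 hw]; simp
    have hv' : 0 < ‖v‖ := lt_of_le_of_ne (norm_nonneg v) (Ne.symm hv)
    have hw' : 0 < ‖w‖ := lt_of_le_of_ne (norm_nonneg w) (Ne.symm hw)
    have h2 : ‖B (((‖v‖⁻¹ : ℝ) : ℂ) • v) (((‖w‖⁻¹ : ℝ) : ℂ) • w)‖ ≤ 2 * (_ + _) := b_bound _ _
    rw [LinearMap.map_smul, LinearMap.map_smulₛₗ, LinearMap.smul_apply, norm_smul, norm_smul,
      norm_smul, norm_smul, RCLike.norm_conj, Complex.norm_real, Complex.norm_real, norm_inv,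
      norm_inv, norm_norm, norm_norm, inv_mul_cancel₀ hv, inv_mul_cancel₀ hw, ← mul_assoc,
      ← mul_inv, inv_mul_le_iff₀ (by positivity)] at h2
    linarith
  let B' : H →L⋆[ℂ] H →L[ℂ] ℂ := B.mkContinuous₂ 4 B_bound
  refine ⟨InnerProductSpace.continuousLinearMapOfBilin B', fun v => ?_⟩
  have hreal : B' v v = q v := by
    change b v v = q v
    simp only [b]
    rw [r_self, r_I]
    simp
  rw [← inner_conj_symm, InnerProductSpace.continuousLinearMapOfBilin_apply, hreal,
    Complex.conj_ofReal]

end QuadraticForm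

/-! ### Observables and postprocessings through Fourier transforms. -/

section ObservableLemmas

variable {H : Type*} [NormedAddCommGroup H] [InnerProductSpace ℂ H] [CompleteSpace H]
  {α : Type*} [MeasurableSpace α]

lemma Observable.diagMeasure_univ (E : Observable α H) (ψ : H) :
    E.diagMeasure ψ Set.univ = ENNReal.ofReal (‖ψ‖ ^ 2) := by
  rw [E.diagMeasure_apply ψ MeasurableSet.univ, E.univ, one_apply_eq_self]
  exact congrArg _ (inner_self_eq_norm_sq (𝕜 := ℂ) ψ)

instance Observable.isFiniteMeasure_diagMeasure (E : Observable α H) (ψ : H) :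
    IsFiniteMeasure (E.diagMeasure ψ) :=
  ⟨by rw [E.diagMeasure_univ]; exact ENNReal.ofReal_lt_top⟩

lemma Observable.inner_self_toFun (E : Observable α H) (ψ : H) {X : Set α} (hX : MeasurableSet X) :
    ⟪ψ, E.toFun X ψ⟫_ℂ = (E.diagMeasure ψ).real X := by
  rw [measureReal_def, E.diagMeasure_apply ψ hX, ENNReal.toReal_ofReal (E.re_nonneg X ψ)]
  have h := ((ContinuousLinearMap.isPositive_iff_complex _).1
    ((ContinuousLinearMap.nonneg_iff_isPositive _).1 (E.nonneg X)) ψ).1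
  rw [← inner_conj_symm, ← h, Complex.conj_ofReal, Complex.ofReal_re]

lemma inner_apply_polarization {V : Type*} [NormedAddCommGroup V] [InnerProductSpace ℂ V]
    (S : V →L[ℂ] V) (φ ψ : V) : ⟪φ, S ψ⟫_ℂ =
    (⟪ψ + φ, S (ψ + φ)⟫_ℂ - ⟪ψ - φ, S (ψ - φ)⟫_ℂ +
      Complex.I * ⟪ψ + Complex.I • φ, S (ψ + Complex.I • φ)⟫_ℂ -
      Complex.I * ⟪ψ - Complex.I • φ, S (ψ - Complex.I • φ)⟫_ℂ) / 4 := by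
  simp only [map_add, map_sub, map_smul, inner_add_left, inner_add_right, inner_sub_left,
    inner_sub_right, inner_smul_left, inner_smul_right, Complex.conj_I]
  linear_combination (⟪φ, S ψ⟫_ℂ / 2 - ⟪ψ, S φ⟫_ℂ / 2) * Complex.I_sq

variable {M : ℕ}

/-- A family of operators whose diagonal matrix elements are Fourier transforms of finite measures
is the Fourier transform of an observable. -/
theorem exists_observable_hasIntegral (C : (Fin M → ℝ) → (H →L[ℂ] H)) (hC0 : C 0 = 1)
    (hC : ∀ ψ : H, ∃ μ : Measure (Fin M → ℝ), IsFiniteMeasure μ ∧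
      ∀ p, ∫ x, Complex.exp (Complex.I * ((p ⬝ᵥ x : ℝ) : ℂ)) ∂μ = ⟪ψ, C p ψ⟫_ℂ) :
    ∃ E : Observable (Fin M → ℝ) H, ∀ p,
      E.HasIntegral (fun x => Complex.exp (Complex.I * ((p ⬝ᵥ x : ℝ) : ℂ))) (C p) := by
  classical
  choose μ hμ hμC using hC
  have huniv : ∀ ψ, (μ ψ).real Set.univ = ‖ψ‖ ^ 2 := by
    intro ψ
    have h := hμC ψ 0
    rw [hC0, one_apply_eq_self, inner_self_eq_norm_sq_to_K] at h
    simp only [zero_dotProduct, Complex.ofReal_zero, mul_zero, Complex.exp_zero, integral_const,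
      Complex.real_smul, mul_one] at h
    exact Complex.ofReal_injective (h.trans (Complex.ofReal_pow _ _).symm)
  -- A relation valid for all operators holds for every `C p`, hence for the transforms of the `μ
  -- v`, hence for their values on `X`.
  have hT : ∀ X : Set (Fin M → ℝ), ∃ T : H →L[ℂ] H, ∀ v, ⟪v, T v⟫_ℂ = (μ v).real X := fun X =>
    exists_operator_of_quadratic (fun v => (μ v).real X)
      (fun n a v hv => sum_mul_measureReal_eq_zero (fun i => μ (v i)) a (fun p => by
        simp only [hμC]; exact hv (C p)) X)
      (fun v => measureReal_nonneg)
      (fun v => (huniv v).symm ▸ measureReal_mono (Set.subset_univ X))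
  choose T hT using hT
  let E : Observable (Fin M → ℝ) H :=
    { toFun := fun X => if MeasurableSet X then T X else 0
      nonneg := fun X => by
        split_ifs
        · rw [ContinuousLinearMap.nonneg_iff_isPositive,
            ContinuousLinearMap.isPositive_iff_complex]
          intro v
          have h1 : ⟪T X v, v⟫_ℂ = (μ v).real X := by
            rw [← inner_conj_symm, hT, Complex.conj_ofReal]
          rw [h1]
          exact ⟨by simp, by simp⟩
        · exact le_rfl
      not_measurable := fun X hX => if_neg hX
      univ := by
        rw [if_pos MeasurableSet.univ]
        have h : (T Set.univ : H →ₗ[ℂ] H) = ((1 : H →L[ℂ] H) : H →ₗ[ℂ] H) := by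
          refine (ext_inner_map _ _).1 fun v => ?_
          change ⟪T Set.univ v, v⟫_ℂ = ⟪v, v⟫_ℂ
          rw [← inner_conj_symm, hT, huniv, Complex.conj_ofReal, inner_self_eq_norm_sq_to_K]
          push_cast
          rfl
        exact ContinuousLinearMap.coe_injective h
      hasSum_iUnion := fun X hX hd φ ψ => by
        have hdiag : ∀ v : H, HasSum (fun i => ⟪v, T (X i) v⟫_ℂ) ⟪v, T (⋃ i, X i) v⟫_ℂ := by
          intro v
          simp only [hT]
          refine Complex.hasSum_ofReal.2 ?_
          have h := ENNReal.hasSum_toReal (measure_iUnion hd hX ▸ measure_ne_top (μ v) (⋃ i, X i))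
          rwa [← ENNReal.tsum_toReal_eq fun i => measure_ne_top _ _, ← measure_iUnion hd hX] at h
        simp only [if_pos (hX _), if_pos (MeasurableSet.iUnion hX)]
        simp_rw [inner_apply_polarization _ φ ψ]
        exact (((((hdiag _).sub (hdiag _)).add ((hdiag _).mul_left _)).sub
          ((hdiag _).mul_left _)).div_const 4) }
  have hE : ∀ ψ, E.diagMeasure ψ = μ ψ := by
    intro ψ
    ext X hX
    rw [E.diagMeasure_apply ψ hX]
    change ENNReal.ofReal (⟪ψ, (if MeasurableSet X then T X else 0) ψ⟫_ℂ).re = _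
    rw [if_pos hX, hT, Complex.ofReal_re, ofReal_measureReal]
  refine ⟨E, fun p ψ => ?_⟩
  rw [hE]
  exact ⟨integrable_exp_I_mul_dotProduct _ p, hμC ψ p⟩

/-- Postprocessing is determined by the Fourier transform. -/
lemma isPostprocessing_iff {M' : ℕ} (E : Observable (Fin M' → ℝ) H) (G : Observable (Fin M → ℝ) H)
    (f : Kernel (Fin M → ℝ) (Fin M' → ℝ)) [IsMarkovKernel f] :
    E.IsPostprocessing G f ↔ ∀ (ψ : H) (p : Fin M' → ℝ),
      ∫ y, Complex.exp (Complex.I * ((p ⬝ᵥ y : ℝ) : ℂ)) ∂(E.diagMeasure ψ) =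
        ∫ x, ∫ y, Complex.exp (Complex.I * ((p ⬝ᵥ y : ℝ) : ℂ)) ∂(f x) ∂(G.diagMeasure ψ) := by
  have hbind : ∀ (ψ : H) (p : Fin M' → ℝ),
      ∫ y, Complex.exp (Complex.I * ((p ⬝ᵥ y : ℝ) : ℂ)) ∂(f ∘ₘ G.diagMeasure ψ) =
        ∫ x, ∫ y, Complex.exp (Complex.I * ((p ⬝ᵥ y : ℝ) : ℂ)) ∂(f x) ∂(G.diagMeasure ψ) :=
    fun ψ p => by
      have h := Kernel.integral_comp (η := f) (κ := Kernel.const Unit (G.diagMeasure ψ)) (a := ())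
        (f := fun y => Complex.exp (Complex.I * ((p ⬝ᵥ y : ℝ) : ℂ)))
        (integrable_exp_I_mul_dotProduct _ p)
      rwa [Kernel.comp_const, Kernel.const_apply, Kernel.const_apply] at h
  have hreal : ∀ (ψ : H) (X : Set (Fin M' → ℝ)), MeasurableSet X →
      Integrable (fun x => ((f x).real X : ℂ)) (G.diagMeasure ψ) ∧
      ∫ x, ((f x).real X : ℂ) ∂(G.diagMeasure ψ) = ((f ∘ₘ G.diagMeasure ψ).real X : ℂ) := by
    intro ψ X hX
    have hm : Measurable fun x => (f x).real X := (f.measurable_coe hX).ennreal_toReal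
    refine ⟨Integrable.of_bound hm.complex_ofReal.aestronglyMeasurable 1
      (Filter.Eventually.of_forall fun x => ?_), ?_⟩
    · rw [Complex.norm_real, Real.norm_of_nonneg measureReal_nonneg]
      exact measureReal_le_one
    · rw [integral_complex_ofReal, measureReal_def (μ := f ∘ₘ _), Measure.bind_apply hX (by fun_prop)]
      congr 1
      rw [integral_eq_lintegral_of_nonneg_ae
        (Filter.Eventually.of_forall fun x => measureReal_nonneg) hm.aestronglyMeasurable]
      exact congrArg _ (lintegral_congr fun x => ofReal_measureReal)
  constructor
  · intro h ψ p
    rw [← hbind]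
    congr 1
    ext X hX
    have h1 := (h X hX ψ).2
    rw [(hreal ψ X hX).2, E.inner_self_toFun ψ hX, Complex.ofReal_inj] at h1
    exact ((measureReal_eq_measureReal_iff).1 h1).symm
  · intro h X hX ψ
    have heq : E.diagMeasure ψ = f ∘ₘ G.diagMeasure ψ :=
      measure_ext_of_integral_exp fun p => by rw [h, hbind]
    exact ⟨(hreal ψ X hX).1, by rw [(hreal ψ X hX).2, E.inner_self_toFun ψ hX, heq]⟩

end ObservableLemmas

/-! ### Existence of Gaussian observables. -/

section GaussianExistence

variable {N M : ℕ}

/-- Gaussian observables with any admissible parameters exist. -/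
theorem exists_hasParams {K : Matrix (PhaseIdx N) (Fin M) ℝ} {L : Matrix (Fin M) (Fin M) ℝ}
    (h : (L.map Complex.ofReal - Complex.I • (Kᵀ * Omega N * K).map Complex.ofReal).PosSemidef)
    (m : Fin M → ℝ) : ∃ E : Observable (Fin M → ℝ) (ModeSpace N), HasParams E K L m := by
  refine exists_observable_hasIntegral _ ?_ fun ψ => ?_
  · ext1 ψ
    simp [weyl_zero]
  · simp only [_root_.smul_apply, inner_smul_right]
    refine (isPosDefFun_gaussian_weyl h m ψ).exists_measure ?_ (sq_nonneg ‖ψ‖) ?_ fun p => ?_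
    · have h1 : Continuous fun p : Fin M → ℝ => p ⬝ᵥ L *ᵥ p :=
        continuous_id.dotProduct (continuous_const.matrix_mulVec continuous_id)
      have h2 : Continuous fun p : Fin M → ℝ => m ⬝ᵥ p := continuous_const.dotProduct continuous_id
      have h3 : Continuous fun p : Fin M → ℝ => ⟪ψ, weyl (K *ᵥ p) ψ⟫_ℂ :=
        (continuous_inner_weyl ψ ψ).comp (continuous_const.matrix_mulVec continuous_id)
      fun_prop
    · simp [weyl_zero, inner_self_eq_norm_sq_to_K]
    · have hn : ‖⟪ψ, weyl (K *ᵥ p) ψ⟫_ℂ‖ ≤ ‖ψ‖ ^ 2 := by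
        refine (norm_inner_le_norm _ _).trans ?_
        rw [norm_weyl_apply, sq]
      rw [norm_mul, Complex.norm_exp]
      have he : Real.exp (-((p ⬝ᵥ L *ᵥ p : ℝ) : ℂ) / 4 - Complex.I * ((m ⬝ᵥ p : ℝ) : ℂ)).re ≤ 1 := by
        rw [Real.exp_le_one_iff]
        have := dotProduct_mulVec_nonneg_of_posSemidef_sub h p
        have e : (-((p ⬝ᵥ L *ᵥ p : ℝ) : ℂ) / 4 - Complex.I * ((m ⬝ᵥ p : ℝ) : ℂ)).re =
            -(p ⬝ᵥ L *ᵥ p) / 4 := by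
          simp [Complex.sub_re, -Complex.ofReal_neg]
        rw [e]
        linarith
      calc _ ≤ 1 * ‖ψ‖ ^ 2 := mul_le_mul he hn (norm_nonneg _) zero_le_one
        _ = _ := one_mul _

end GaussianExistence

/-! ### Complex positivity in terms of real vectors. -/

section RealPosSemidef

variable {ι : Type*} [Fintype ι]

lemma dotProduct_mulVec_comm_of_isSymm {B : Matrix ι ι ℝ} (hB : B.IsSymm) (x y : ι → ℝ) :
    y ⬝ᵥ B *ᵥ x = x ⬝ᵥ B *ᵥ y := by
  rw [dotProduct_mulVec, ← mulVec_transpose, hB.eq, dotProduct_comm]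

lemma dotProduct_mulVec_comm_of_transpose_eq_neg {S : Matrix ι ι ℝ} (hS : Sᵀ = -S) (x y : ι → ℝ) :
    y ⬝ᵥ S *ᵥ x = -(x ⬝ᵥ S *ᵥ y) := by
  rw [dotProduct_mulVec, ← mulVec_transpose, hS, neg_mulVec, neg_dotProduct, dotProduct_comm]

lemma star_dotProduct_sub_mulVec {B S : Matrix ι ι ℝ} (hB : B.IsSymm) (hS : Sᵀ = -S) (x y : ι → ℝ) :
    star (fun i => (x i : ℂ) + Complex.I * y i) ⬝ᵥ
      (B.map Complex.ofReal - Complex.I • S.map Complex.ofReal) *ᵥ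
        (fun i => (x i : ℂ) + Complex.I * y i) =
      ((x ⬝ᵥ B *ᵥ x + y ⬝ᵥ B *ᵥ y + 2 * (x ⬝ᵥ S *ᵥ y) : ℝ) : ℂ) := by
  have h1 : (fun i => (x i : ℂ) + Complex.I * y i) =
      (fun i => (x i : ℂ)) + Complex.I • fun i => (y i : ℂ) := rfl
  have h2 : star (fun i => (x i : ℂ) + Complex.I * y i) =
      (fun i => (x i : ℂ)) - Complex.I • fun i => (y i : ℂ) := by
    ext i
    simp [sub_eq_add_neg]
  have hself : ∀ z : ι → ℝ, z ⬝ᵥ S *ᵥ z = 0 := fun z => by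
    have := dotProduct_mulVec_comm_of_transpose_eq_neg hS z z
    linarith
  rw [h2, h1]
  simp only [sub_mulVec, smul_mulVec, mulVec_add, mulVec_smul, dotProduct_sub, sub_dotProduct,
    dotProduct_add, dotProduct_smul, smul_dotProduct, smul_eq_mul, ← ofReal_dotProduct_mulVec,
    dotProduct_mulVec_comm_of_isSymm hB x y, dotProduct_mulVec_comm_of_transpose_eq_neg hS x y,
    hself]
  push_cast
  linear_combination (-(y ⬝ᵥ B *ᵥ y : ℝ) - 2 * (x ⬝ᵥ S *ᵥ y : ℝ) : ℂ) * Complex.I_sq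

/-- Positivity of `B - iS` for a symmetric `B` and an antisymmetric `S` in terms of real vectors. -/
lemma posSemidef_sub_iff {B S : Matrix ι ι ℝ} (hB : B.IsSymm) (hS : Sᵀ = -S) :
    (B.map Complex.ofReal - Complex.I • S.map Complex.ofReal).PosSemidef ↔
      ∀ x y : ι → ℝ, 0 ≤ x ⬝ᵥ B *ᵥ x + y ⬝ᵥ B *ᵥ y + 2 * (x ⬝ᵥ S *ᵥ y) := by
  rw [Matrix.posSemidef_iff_dotProduct_mulVec]
  constructor
  · intro h x y
    have := h.2 (fun i => (x i : ℂ) + Complex.I * y i)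
    rw [star_dotProduct_sub_mulVec hB hS] at this
    exact Complex.zero_le_real.1 this
  · refine fun h => ⟨?_, fun z => ?_⟩
    · ext i j
      have h1 : B j i = B i j := hB.apply i j
      have h2 : S j i = -S i j := congrFun (congrFun hS i) j
      simp [h1, h2]
      ring
    · have hz : z = fun i => (((z i).re : ℝ) : ℂ) + Complex.I * ((z i).im : ℝ) := by
        ext i
        rw [mul_comm, Complex.re_add_im]
      rw [hz, star_dotProduct_sub_mulVec hB hS]
      exact Complex.zero_le_real.2 (h _ _)

lemma transpose_conj_eq_neg {m n : Type*} [Fintype m] [Fintype n] (A : Matrix m n ℝ)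
    {S : Matrix m m ℝ} (hS : Sᵀ = -S) : (Aᵀ * S * A)ᵀ = -(Aᵀ * S * A) := by
  simp [Matrix.transpose_mul, hS, Matrix.mul_assoc]

lemma Omega_transpose (N : ℕ) : (Omega N)ᵀ = -Omega N := by
  rw [Omega, blockDiagonal_transpose, ← blockDiagonal_neg]
  congr 1
  ext _ i j
  fin_cases i <;> fin_cases j <;> simp

lemma posSemidef_map_ofReal {B : Matrix ι ι ℝ} (hB : B.PosSemidef) :
    (B.map Complex.ofReal - Complex.I • (0 : Matrix ι ι ℝ).map Complex.ofReal).PosSemidef := by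
  have hq : ∀ x : ι → ℝ, 0 ≤ x ⬝ᵥ B *ᵥ x := fun x => by
    simpa using (Matrix.posSemidef_iff_dotProduct_mulVec.1 hB).2 x
  refine (posSemidef_sub_iff (S := 0) (by simpa [IsSymm, IsHermitian] using hB.isHermitian)
    (by simp)).2 fun x y => ?_
  simpa using add_nonneg (hq x) (hq y)

end RealPosSemidef

/-! ### Channels commute with integration. -/

section Channels

variable {H H' : Type*} [NormedAddCommGroup H] [InnerProductSpace ℂ H] [CompleteSpace H]
  [NormedAddCommGroup H'] [InnerProductSpace ℂ H'] [CompleteSpace H']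
  {α : Type*} [MeasurableSpace α]

lemma Channel.exists_inner_eq_tsum (Λ : Channel H' H) (φ ψ : H) :
    ∃ ξ η : ℕ → H', Summable (fun n => ‖ξ n‖ ^ 2) ∧ Summable (fun n => ‖η n‖ ^ 2) ∧
      ∀ A : H' →L[ℂ] H', ⟪φ, Λ.toCP A ψ⟫_ℂ = ∑' n, ⟪ξ n, A (η n)⟫_ℂ := by
  have hs : ∀ θ : H, Summable fun n : ℕ => ‖(Pi.single 0 θ : ℕ → H) n‖ ^ 2 := fun θ =>
    summable_of_ne_finset_zero (s := {0}) fun n hn => by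
      have : n ≠ 0 := by simpa using hn
      simp [this]
  obtain ⟨ξ, η, hξ, hη, h⟩ := Λ.normal (Pi.single 0 φ) (Pi.single 0 ψ) (hs φ) (hs ψ)
  refine ⟨ξ, η, hξ, hη, fun A => ?_⟩
  rw [← h A, tsum_eq_single 0]
  · simp
  · intro n hn
    simp [hn]

/-- The sum of the diagonal measures of a square summable family of vectors is finite, and integrals
against it are sums of matrix elements. -/
lemma Observable.hasSum_of_hasIntegral (E : Observable α H) {ζ : ℕ → H}
    (hζ : Summable fun n => ‖ζ n‖ ^ 2) :
    IsFiniteMeasure (Measure.sum fun n => E.diagMeasure (ζ n)) ∧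
    ∀ (f : α → ℂ) (T : H →L[ℂ] H) (C : ℝ), Measurable f → (∀ x, ‖f x‖ ≤ C) → E.HasIntegral f T →
      HasSum (fun n => ⟪ζ n, T (ζ n)⟫_ℂ) (∫ x, f x ∂(Measure.sum fun n => E.diagMeasure (ζ n))) := by
  have hfin : IsFiniteMeasure (Measure.sum fun n => E.diagMeasure (ζ n)) := by
    refine ⟨?_⟩
    rw [Measure.sum_apply _ MeasurableSet.univ]
    simp_rw [E.diagMeasure_univ]
    rw [← ENNReal.ofReal_tsum_of_nonneg (fun n => sq_nonneg _) hζ]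
    exact ENNReal.ofReal_lt_top
  refine ⟨hfin, fun f T C hf hC hT => ?_⟩
  have h := hasSum_integral_measure (μ := fun n => E.diagMeasure (ζ n)) (f := f)
    (Integrable.of_bound hf.aestronglyMeasurable C (Filter.Eventually.of_forall hC))
  simpa only [(hT _).2] using h

/-- A channel commutes with integration of bounded functions. -/
lemma Channel.hasIntegral_map (Λ : Channel H' H) (E : Observable α H') {f : α → ℂ}
    {T : H' →L[ℂ] H'} {C : ℝ} (hf : Measurable f) (hC : ∀ x, ‖f x‖ ≤ C) (hT : E.HasIntegral f T) :
    (Λ.map E).HasIntegral f (Λ.toCP T) := by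
  intro ψ
  refine ⟨Integrable.of_bound hf.aestronglyMeasurable C (Filter.Eventually.of_forall hC), ?_⟩
  obtain ⟨ξ, η, hξ, hη, h⟩ := Λ.exists_inner_eq_tsum ψ ψ
  have hbound : ∀ c : ℂ, ‖c‖ = 1 → Summable fun n => ‖η n + c • ξ n‖ ^ 2 := by
    intro c hc
    refine Summable.of_nonneg_of_le (fun n => sq_nonneg _) (fun n => ?_)
      ((hη.mul_left 2).add (hξ.mul_left 2))
    have h1 := norm_add_le (η n) (c • ξ n)
    rw [norm_smul, hc, one_mul] at h1
    nlinarith [norm_nonneg (η n + c • ξ n), sq_nonneg (‖η n‖ - ‖ξ n‖)]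
  -- Polarisation writes the normal functional `A ↦ ⟨ψ, Λ(A)ψ⟩` through four finite positive
  -- measures, `c = ±1, ±i`.
  let μ : ℂ → Measure α := fun c => Measure.sum fun n => E.diagMeasure (η n + c • ξ n)
  have hμ : ∀ c : ℂ, ‖c‖ = 1 → IsFiniteMeasure (μ c) := fun c hc =>
    (E.hasSum_of_hasIntegral (hbound c hc)).1
  have hsum : ∀ (g : α → ℂ) (S : H' →L[ℂ] H') (D : ℝ), Measurable g → (∀ x, ‖g x‖ ≤ D) →
      E.HasIntegral g S → ⟪ψ, Λ.toCP S ψ⟫_ℂ = (∫ x, g x ∂(μ 1) - ∫ x, g x ∂(μ (-1)) +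
        Complex.I * ∫ x, g x ∂(μ Complex.I) - Complex.I * ∫ x, g x ∂(μ (-Complex.I))) / 4 := by
    intro g S D hg hD hS
    have hc : ∀ c : ℂ, ‖c‖ = 1 → HasSum (fun n => ⟪η n + c • ξ n, S (η n + c • ξ n)⟫_ℂ)
        (∫ x, g x ∂(μ c)) := fun c hc =>
      (E.hasSum_of_hasIntegral (hbound c hc)).2 g S D hg hD hS
    rw [h S]
    simp_rw [inner_apply_polarization S (ξ _) (η _)]
    have := ((((hc 1 (by simp)).sub (hc (-1) (by simp))).add
      ((hc Complex.I (by simp)).mul_left Complex.I)).sub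
      ((hc (-Complex.I) (by simp)).mul_left Complex.I)).div_const 4
    simp only [one_smul, neg_smul, ← sub_eq_add_neg] at this
    exact this.tsum_eq
  have := hμ 1 (by simp)
  have := hμ (-1) (by simp)
  have := hμ Complex.I (by simp)
  have := hμ (-Complex.I) (by simp)
  -- Indicators identify the measures: real and imaginary parts give two relations, arranged
  -- additively so that only positive measures occur.
  have hset : ∀ X, MeasurableSet X →
      4 * ((Λ.map E).diagMeasure ψ).real X + (μ (-1)).real X = (μ 1).real X ∧
        (μ Complex.I).real X = (μ (-Complex.I)).real X := by
    intro X hX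
    have hI : E.HasIntegral (X.indicator fun _ => (1 : ℂ)) (E.toFun X) := by
      intro θ
      refine ⟨(integrable_const _).indicator hX, ?_⟩
      rw [integral_indicator_const _ hX, E.inner_self_toFun θ hX]
      simp
    have h1 := hsum (X.indicator fun _ => (1 : ℂ)) (E.toFun X) 1
      (measurable_const.indicator hX)
      (fun x => (norm_indicator_le_norm_self _ _).trans (by simp)) hI
    have h2 : ⟪ψ, Λ.toCP (E.toFun X) ψ⟫_ℂ = ((Λ.map E).diagMeasure ψ).real X :=
      (Λ.map E).inner_self_toFun ψ hX
    rw [h2] at h1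
    simp only [integral_indicator_const _ hX, Complex.real_smul, mul_one] at h1
    have hre := congrArg Complex.re h1
    have him := congrArg Complex.im h1
    simp at hre him
    constructor <;> linarith
  have hI : μ Complex.I = μ (-Complex.I) := by
    ext X hX
    exact (measureReal_eq_measureReal_iff).1 (hset X hX).2
  have h4 : (4 : NNReal) • (Λ.map E).diagMeasure ψ + μ (-1) = μ 1 := by
    ext X hX
    refine (measureReal_eq_measureReal_iff).1 ?_
    rw [measureReal_add_apply, measureReal_nnreal_smul_apply]
    exact (hset X hX).1
  have hint : ∀ (ν : Measure α) [IsFiniteMeasure ν], Integrable f ν := fun ν _ =>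
    Integrable.of_bound hf.aestronglyMeasurable C (Filter.Eventually.of_forall hC)
  rw [hsum f T C hf hC hT, hI, ← h4, integral_add_measure (hint _) (hint _),
    integral_smul_nnreal_measure, NNReal.smul_def, Complex.real_smul]
  push_cast
  ring

end Channels

/-! ### Calculus and uniqueness of parameters. -/

section Params

variable {N N' M M' : ℕ}

lemma measurable_exp_I_mul_dotProduct (p : Fin M → ℝ) :
    Measurable fun x : Fin M → ℝ => Complex.exp (Complex.I * ((p ⬝ᵥ x : ℝ) : ℂ)) := by
  refine Continuous.measurable ?_
  unfold dotProduct
  fun_prop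

/-- The parameters of the image of an observable under a Gaussian channel. -/
lemma HasParams.map {Λ : Channel (ModeSpace N') (ModeSpace N)}
    {A : Matrix (PhaseIdx N) (PhaseIdx N') ℝ} {B : Matrix (PhaseIdx N') (PhaseIdx N') ℝ}
    {c : Phase N'} (hΛ : ∀ x : Phase N', Λ.toCP (weyl x) =
      Complex.exp (-((x ⬝ᵥ B *ᵥ x : ℝ) : ℂ) / 4 - Complex.I * ((c ⬝ᵥ x : ℝ) : ℂ)) • weyl (A *ᵥ x))
    {E : Observable (Fin M → ℝ) (ModeSpace N')} {K : Matrix (PhaseIdx N') (Fin M) ℝ}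
    {L : Matrix (Fin M) (Fin M) ℝ} {m : Fin M → ℝ} (hE : HasParams E K L m) :
    HasParams (Λ.map E) (A * K) (L + Kᵀ * B * K) (m + Kᵀ *ᵥ c) := by
  intro p
  have h := Λ.hasIntegral_map E (measurable_exp_I_mul_dotProduct p) (C := 1) (fun x => by
    rw [mul_comm, Complex.norm_exp_ofReal_mul_I]) (hE p)
  rw [map_smul, hΛ, smul_smul, ← Complex.exp_add, mulVec_mulVec p A K] at h
  convert h using 3
  rw [add_mulVec, dotProduct_add, dotProduct_conj_mulVec, add_dotProduct, mulVec_transpose,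
    ← dotProduct_mulVec]
  push_cast
  ring

/-- The parameters of a Gaussian postprocessing of a Gaussian observable. -/
lemma isPostprocessing_iff_hasParams {E : Observable (Fin M' → ℝ) (ModeSpace N)}
    {G : Observable (Fin M → ℝ) (ModeSpace N)} {K : Matrix (PhaseIdx N) (Fin M) ℝ}
    {L : Matrix (Fin M) (Fin M) ℝ} {m : Fin M → ℝ} (hG : HasParams G K L m)
    {f : Kernel (Fin M → ℝ) (Fin M' → ℝ)} [IsMarkovKernel f] {A : Matrix (Fin M) (Fin M') ℝ}
    {B : Matrix (Fin M') (Fin M') ℝ} {c : Fin M' → ℝ}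
    (hf : ∀ (p : Fin M' → ℝ) (x : Fin M → ℝ),
      ∫ y, Complex.exp (Complex.I * ((p ⬝ᵥ y : ℝ) : ℂ)) ∂(f x) =
        Complex.exp (-((p ⬝ᵥ B *ᵥ p : ℝ) : ℂ) / 4 - Complex.I * ((c ⬝ᵥ p : ℝ) : ℂ)) *
          Complex.exp (Complex.I * (((A *ᵥ p) ⬝ᵥ x : ℝ) : ℂ))) :
    E.IsPostprocessing G f ↔ HasParams E (K * A) (B + Aᵀ * L * A) (c + Aᵀ *ᵥ m) := by
  have key : ∀ (ψ : ModeSpace N) (p : Fin M' → ℝ),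
      ∫ x, ∫ y, Complex.exp (Complex.I * ((p ⬝ᵥ y : ℝ) : ℂ)) ∂(f x) ∂(G.diagMeasure ψ) =
        ⟪ψ, (Complex.exp (-((p ⬝ᵥ (B + Aᵀ * L * A) *ᵥ p : ℝ) : ℂ) / 4 -
          Complex.I * (((c + Aᵀ *ᵥ m) ⬝ᵥ p : ℝ) : ℂ)) • weyl ((K * A) *ᵥ p)) ψ⟫_ℂ := by
    intro ψ p
    simp_rw [hf p]
    rw [integral_const_mul, (hG (A *ᵥ p) ψ).2, _root_.smul_apply, _root_.smul_apply,
      inner_smul_right, inner_smul_right, ← mul_assoc, ← Complex.exp_add, mulVec_mulVec p K A]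
    congr 2
    rw [add_mulVec, dotProduct_add, dotProduct_conj_mulVec, add_dotProduct, mulVec_transpose,
      ← dotProduct_mulVec]
    push_cast
    ring
  rw [isPostprocessing_iff]
  constructor
  · intro h p ψ
    exact ⟨integrable_exp_I_mul_dotProduct _ p, (h ψ p).trans (key ψ p)⟩
  · intro h ψ p
    rw [key]
    exact (h p ψ).2

/-- Gaussian postprocessings with any admissible parameters exist. -/
lemma exists_gaussianKernel (A : Matrix (Fin M) (Fin M') ℝ) {B : Matrix (Fin M') (Fin M') ℝ}
    (hB : B.PosSemidef) (c : Fin M' → ℝ) :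
    ∃ f : Kernel (Fin M → ℝ) (Fin M' → ℝ), IsMarkovKernel f ∧
      ∀ (p : Fin M' → ℝ) (x : Fin M → ℝ),
        ∫ y, Complex.exp (Complex.I * ((p ⬝ᵥ y : ℝ) : ℂ)) ∂(f x) =
          Complex.exp (-((p ⬝ᵥ B *ᵥ p : ℝ) : ℂ) / 4 - Complex.I * ((c ⬝ᵥ p : ℝ) : ℂ)) *
            Complex.exp (Complex.I * (((A *ᵥ p) ⬝ᵥ x : ℝ) : ℂ)) := by
  -- With zero modes and a unit vector, a Gaussian observable is just a Gaussian probability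
  -- measure, possibly degenerate. It serves as noise added to `Aᵀx`.
  obtain ⟨E, hE⟩ := exists_hasParams (N := 0) (K := 0) (L := B)
    (by simpa using posSemidef_map_ofReal hB) c
  obtain ⟨ψ₀, hψ₀⟩ := exists_modeSpace_norm_pos 0
  let ψ : ModeSpace 0 := ((‖ψ₀‖⁻¹ : ℝ) : ℂ) • ψ₀
  have hψ : ‖ψ‖ = 1 := by
    rw [norm_smul, Complex.norm_real, norm_inv, norm_norm, inv_mul_cancel₀ hψ₀.ne']
  have hprob : IsProbabilityMeasure (E.diagMeasure ψ) :=
    ⟨by rw [E.diagMeasure_univ, hψ]; simp⟩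
  have hchar : ∀ p : Fin M' → ℝ, ∫ y, Complex.exp (Complex.I * ((p ⬝ᵥ y : ℝ) : ℂ))
      ∂(E.diagMeasure ψ) =
        Complex.exp (-((p ⬝ᵥ B *ᵥ p : ℝ) : ℂ) / 4 - Complex.I * ((c ⬝ᵥ p : ℝ) : ℂ)) := by
    intro p
    rw [(hE p ψ).2, zero_mulVec, _root_.smul_apply, weyl_zero, inner_smul_right,
      inner_self_eq_norm_sq_to_K, hψ]
    simp
  have hm : Measurable fun z : (Fin M → ℝ) × (Fin M' → ℝ) => Aᵀ *ᵥ z.1 + z.2 := by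
    have : Continuous fun z : (Fin M → ℝ) × (Fin M' → ℝ) => Aᵀ *ᵥ z.1 + z.2 :=
      (continuous_const.matrix_mulVec continuous_fst).add continuous_snd
    exact this.measurable
  refine ⟨(Kernel.id ×ₖ Kernel.const _ (E.diagMeasure ψ)).map fun z => Aᵀ *ᵥ z.1 + z.2,
    Kernel.IsMarkovKernel.map _ hm, fun p x => ?_⟩
  rw [Kernel.map_apply _ hm, integral_map hm.aemeasurable
    (measurable_exp_I_mul_dotProduct p).aestronglyMeasurable, Kernel.prod_apply, Kernel.id_apply,
    Kernel.const_apply, Measure.dirac_prod, integral_map (by fun_prop)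
    (show Measurable fun z : (Fin M → ℝ) × (Fin M' → ℝ) =>
      Complex.exp (Complex.I * ((p ⬝ᵥ (Aᵀ *ᵥ z.1 + z.2) : ℝ) : ℂ)) from
        (measurable_exp_I_mul_dotProduct p).comp hm).aestronglyMeasurable, ← hchar,
    ← integral_mul_const]
  congr 1 with y
  rw [← Complex.exp_add, dotProduct_add, mulVec_transpose, dotProduct_comm p (x ᵥ* A),
    ← dotProduct_mulVec, dotProduct_comm x]
  congr 1
  push_cast
  ring

/-- An observable determines the quadratic form of its parameter `L`, and the Weyl operators `W(Kp)`
up to scalars. -/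
lemma HasParams.dotProduct_mulVec_eq {E : Observable (Fin M → ℝ) (ModeSpace N)}
    {K K' : Matrix (PhaseIdx N) (Fin M) ℝ} {L L' : Matrix (Fin M) (Fin M) ℝ} {m m' : Fin M → ℝ}
    (h : HasParams E K L m) (h' : HasParams E K' L' m') (p : Fin M → ℝ) :
    p ⬝ᵥ L *ᵥ p = p ⬝ᵥ L' *ᵥ p ∧ ∃ u : ℂ, u ≠ 0 ∧ weyl (K *ᵥ p) = u • weyl (K' *ᵥ p) := by
  set a := Complex.exp (-((p ⬝ᵥ L *ᵥ p : ℝ) : ℂ) / 4 - Complex.I * ((m ⬝ᵥ p : ℝ) : ℂ)) with ha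
  set a' := Complex.exp (-((p ⬝ᵥ L' *ᵥ p : ℝ) : ℂ) / 4 - Complex.I * ((m' ⬝ᵥ p : ℝ) : ℂ)) with ha'
  have heq : a • weyl (K *ᵥ p) = a' • weyl (K' *ᵥ p) := by
    refine ContinuousLinearMap.coe_injective ((ext_inner_map _ _).1 fun ψ => ?_)
    have h1 : ⟪ψ, (a • weyl (K *ᵥ p)) ψ⟫_ℂ = ⟪ψ, (a' • weyl (K' *ᵥ p)) ψ⟫_ℂ :=
      (h p ψ).2.symm.trans (h' p ψ).2
    rw [← inner_conj_symm, ← inner_conj_symm (_ : ModeSpace N) ψ]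
    exact congrArg _ h1
  refine ⟨?_, a⁻¹ * a', mul_ne_zero (inv_ne_zero (Complex.exp_ne_zero _)) (Complex.exp_ne_zero _),
    ?_⟩
  · obtain ⟨ψ, hψ⟩ := exists_modeSpace_norm_pos N
    have h1 := congrArg (fun T : ModeSpace N →L[ℂ] ModeSpace N => ‖T ψ‖) heq
    -- Weyl operators are isometric, so norms retain only the real Gaussian factor.
    simp only [_root_.smul_apply, norm_smul, norm_weyl_apply] at h1
    have h2 := mul_right_cancel₀ hψ.ne' h1
    rw [ha, ha', Complex.norm_exp, Complex.norm_exp, Real.exp_eq_exp] at h2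
    have e : ∀ s t : ℝ, (-(s : ℂ) / 4 - Complex.I * (t : ℂ)).re = -s / 4 := fun s t => by
      simp [Complex.sub_re, -Complex.ofReal_neg]
    rw [e, e] at h2
    linarith
  · rw [mul_smul, ← heq, smul_smul, inv_mul_cancel₀ (Complex.exp_ne_zero _), one_smul]

lemma weyl_comm (x y : Phase N) (ψ : ModeSpace N) :
    weyl x (weyl y ψ) =
      Complex.exp (-Complex.I * ((x ⬝ᵥ Omega N *ᵥ y : ℝ) : ℂ)) • weyl y (weyl x ψ) := by
  rw [weyl_weyl, weyl_weyl, smul_smul, ← Complex.exp_add, add_comm y x,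
    dotProduct_mulVec_comm_of_transpose_eq_neg (Omega_transpose N) x y]
  congr 2
  push_cast
  ring

/-- Nonzero scalars cancel from the commutation relation, so its phase depends only on the operators
up to scalars. -/
lemma exp_eq_exp_of_weyl_eq_smul {x x' y y' : Phase N} {u v : ℂ} (hu : u ≠ 0) (hv : v ≠ 0)
    (hx : weyl x = u • weyl x') (hy : weyl y = v • weyl y') :
    Complex.exp (-Complex.I * ((x ⬝ᵥ Omega N *ᵥ y : ℝ) : ℂ)) =
      Complex.exp (-Complex.I * ((x' ⬝ᵥ Omega N *ᵥ y' : ℝ) : ℂ)) := by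
  obtain ⟨ψ, hψ⟩ := exists_modeSpace_norm_pos N
  have h := weyl_comm x y ψ
  rw [hx, hy] at h
  simp only [_root_.smul_apply, map_smul] at h
  rw [weyl_comm x' y' ψ] at h
  simp only [smul_smul] at h
  have hne : weyl y' (weyl x' ψ) ≠ 0 := by
    rwa [← norm_pos_iff, norm_weyl_apply, norm_weyl_apply]
  have h' := smul_left_injective ℂ hne h
  exact mul_left_cancel₀ (mul_ne_zero hu hv) (by linear_combination -h')

/-- If `s ≠ t`, the choice `r = π/(s - t)` makes the ratio of the two sides `-1`. -/
lemma eq_of_forall_exp_mul_eq {s t : ℝ}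
    (h : ∀ r : ℝ, Complex.exp (-Complex.I * ((r * s : ℝ) : ℂ)) =
      Complex.exp (-Complex.I * ((r * t : ℝ) : ℂ))) : s = t := by
  by_contra hne
  have hd : s - t ≠ 0 := sub_ne_zero.2 hne
  have h1 := h (Real.pi / (s - t))
  rw [← div_eq_one_iff_eq (Complex.exp_ne_zero _), ← Complex.exp_sub] at h1
  have e : -Complex.I * ((Real.pi / (s - t) * s : ℝ) : ℂ) -
      -Complex.I * ((Real.pi / (s - t) * t : ℝ) : ℂ) = -(Real.pi * Complex.I) := by
    have : Real.pi / (s - t) * s - Real.pi / (s - t) * t = Real.pi := by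
      rw [← mul_sub, div_mul_cancel₀ _ hd]
    rw [← mul_sub, ← Complex.ofReal_sub, this]
    ring
  rw [e, Complex.exp_neg, Complex.exp_pi_mul_I] at h1
  norm_num at h1

/-- Symplectic products are read off from commutators of the Weyl operators, without comparing the
matrices `K` themselves. Scaling `p` by every real `r` removes the `2π` ambiguity of the phase. -/
lemma HasParams.omega_eq {E₁ : Observable (Fin M → ℝ) (ModeSpace N)}
    {E₂ : Observable (Fin M' → ℝ) (ModeSpace N)}
    {K₁ K₁' : Matrix (PhaseIdx N) (Fin M) ℝ} {L₁ L₁' : Matrix (Fin M) (Fin M) ℝ} {m₁ m₁' : Fin M → ℝ}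
    {K₂ K₂' : Matrix (PhaseIdx N) (Fin M') ℝ} {L₂ L₂' : Matrix (Fin M') (Fin M') ℝ}
    {m₂ m₂' : Fin M' → ℝ}
    (h₁ : HasParams E₁ K₁ L₁ m₁) (h₁' : HasParams E₁ K₁' L₁' m₁')
    (h₂ : HasParams E₂ K₂ L₂ m₂) (h₂' : HasParams E₂ K₂' L₂' m₂') (p : Fin M → ℝ) (q : Fin M' → ℝ) :
    (K₁ *ᵥ p) ⬝ᵥ Omega N *ᵥ (K₂ *ᵥ q) = (K₁' *ᵥ p) ⬝ᵥ Omega N *ᵥ (K₂' *ᵥ q) := by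
  refine eq_of_forall_exp_mul_eq fun r => ?_
  obtain ⟨u, hu, hu'⟩ := (h₁.dotProduct_mulVec_eq h₁' (r • p)).2
  obtain ⟨v, hv, hv'⟩ := (h₂.dotProduct_mulVec_eq h₂' q).2
  have := exp_eq_exp_of_weyl_eq_smul hu hv hu' hv'
  simpa only [mulVec_smul, smul_dotProduct, smul_eq_mul] using this

end Params

/-! ### The matrix criterion for breaking Gaussian incompatibility. -/

section Main

variable {N N' : ℕ}

lemma BreaksGaussianIncompatibility.mono {Λ : Channel (ModeSpace N') (ModeSpace N)}
    {S T : Set (EuclObs N')} (hST : S ⊆ T) (h : BreaksGaussianIncompatibility Λ T) :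
    BreaksGaussianIncompatibility Λ S := by
  obtain ⟨M, G, hG, hE⟩ := h
  exact ⟨M, G, hG, fun E hES => hE E (Set.image_mono hST hES)⟩

/-- A `1 × 1` antisymmetric matrix vanishes; hence a quadrature is admissible without noise. -/
lemma replicateCol_conj_Omega (k : Phase N) :
    (replicateCol (Fin 1) k)ᵀ * Omega N * replicateCol (Fin 1) k = 0 := by
  have h := transpose_conj_eq_neg (replicateCol (Fin 1) k) (Omega_transpose N)
  ext i j
  have hij := congrFun (congrFun h i) j
  rw [transpose_apply, Subsingleton.elim j i, Matrix.neg_apply] at hij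
  rw [Subsingleton.elim j i, Matrix.zero_apply]
  linarith

lemma posSemidef_quadrature (k : Phase N) :
    ((0 : Matrix (Fin 1) (Fin 1) ℝ).map Complex.ofReal - Complex.I •
      ((replicateCol (Fin 1) k)ᵀ * Omega N * replicateCol (Fin 1) k).map
        Complex.ofReal).PosSemidef := by
  rw [replicateCol_conj_Omega]
  exact posSemidef_map_ofReal .zero

lemma generalisedQuadratures_subset : generalisedQuadratures N ⊆ gaussianObservables N := by
  rintro _ ⟨k, F, hF, rfl⟩
  exact ⟨_, _, _, posSemidef_quadrature k, hF⟩

/-- If `B - i AᵀΩA ≥ 0`, then all the Gaussian observables are mapped to postprocessings of the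
Gaussian observable with parameters `(A, B, c)`. -/
lemma breaksGaussianIncompatibility_of_posSemidef {Λ : Channel (ModeSpace N') (ModeSpace N)}
    {A : Matrix (PhaseIdx N) (PhaseIdx N') ℝ} {B : Matrix (PhaseIdx N') (PhaseIdx N') ℝ}
    {c : Phase N'} (hΛ : ∀ x : Phase N', Λ.toCP (weyl x) =
      Complex.exp (-((x ⬝ᵥ B *ᵥ x : ℝ) : ℂ) / 4 - Complex.I * ((c ⬝ᵥ x : ℝ) : ℂ)) • weyl (A *ᵥ x))
    (hpos : (B.map Complex.ofReal -
      Complex.I • (Aᵀ * Omega N * A).map Complex.ofReal).PosSemidef) :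
    BreaksGaussianIncompatibility Λ (gaussianObservables N') := by
  -- Outcome spaces are indexed by `Fin M`, so the `2N'` phase space coordinates are renumbered.
  let e := (Fintype.equivFin (PhaseIdx N')).symm
  have hpos' : ((B.submatrix e e).map Complex.ofReal -
      Complex.I • ((A.submatrix id e)ᵀ * Omega N * A.submatrix id e).map
        Complex.ofReal).PosSemidef := hpos.submatrix e
  obtain ⟨G, hG⟩ := exists_hasParams hpos' (c ∘ e)
  refine ⟨_, G, ⟨_, _, _, hpos', hG⟩, ?_⟩
  rintro _ ⟨⟨M, E⟩, ⟨K, L, m, hKL, hE⟩, rfl⟩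
  have hL : L.PosSemidef := by
    rw [Matrix.posSemidef_iff_dotProduct_mulVec]
    exact ⟨by simpa [IsSymm, IsHermitian] using isSymm_of_posSemidef_sub hKL,
      fun x => by simpa using dotProduct_mulVec_nonneg_of_posSemidef_sub hKL x⟩
  -- The parameters of `E` themselves serve as matrix, noise and shift of the postprocessing.
  obtain ⟨f, hf, hf'⟩ := exists_gaussianKernel (K.submatrix e id) hL m
  refine ⟨f, ⟨hf, _, _, _, hL, hf'⟩, (isPostprocessing_iff_hasParams hG hf').2 ?_⟩
  have h := hE.map hΛ
  have e1 : A.submatrix id e * K.submatrix e id = A * K := by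
    rw [submatrix_mul_equiv, submatrix_id_id]
  have e2 : (K.submatrix e id)ᵀ * B.submatrix e e * K.submatrix e id = Kᵀ * B * K := by
    rw [transpose_submatrix, submatrix_mul_equiv, submatrix_mul_equiv, submatrix_id_id]
  have e3 : (K.submatrix e id)ᵀ *ᵥ (c ∘ e) = Kᵀ *ᵥ c := by
    have hc : (c ∘ e) ∘ e.symm = c := by
      ext i
      simp
    rw [transpose_submatrix, submatrix_mulVec_equiv, hc]
    rfl
  rw [e1, e2, e3]
  exact h

/-- The quadratures along `k₁` and `k₂` test the inequality on the complex vector `k₁ + i k₂`, which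
is why pairs suffice. -/
lemma posSemidef_of_breaks_pairs {Λ : Channel (ModeSpace N') (ModeSpace N)}
    {A : Matrix (PhaseIdx N) (PhaseIdx N') ℝ} {B : Matrix (PhaseIdx N') (PhaseIdx N') ℝ}
    {c : Phase N'} (hB : B.IsSymm) (hΛ : ∀ x : Phase N', Λ.toCP (weyl x) =
      Complex.exp (-((x ⬝ᵥ B *ᵥ x : ℝ) : ℂ) / 4 - Complex.I * ((c ⬝ᵥ x : ℝ) : ℂ)) • weyl (A *ᵥ x))
    (h : ∀ E₁ ∈ generalisedQuadratures N', ∀ E₂ ∈ generalisedQuadratures N',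
      BreaksGaussianIncompatibility Λ {E₁, E₂}) :
    (B.map Complex.ofReal - Complex.I • (Aᵀ * Omega N * A).map Complex.ofReal).PosSemidef := by
  refine (posSemidef_sub_iff hB (transpose_conj_eq_neg A (Omega_transpose N))).2 fun k₁ k₂ => ?_
  obtain ⟨Q₁, hQ₁⟩ := exists_hasParams (posSemidef_quadrature k₁) 0
  obtain ⟨Q₂, hQ₂⟩ := exists_hasParams (posSemidef_quadrature k₂) 0
  obtain ⟨M, G, ⟨K, L, m, hKL, hG⟩, hE⟩ := h ⟨1, Q₁⟩ ⟨k₁, Q₁, hQ₁, rfl⟩ ⟨1, Q₂⟩ ⟨k₂, Q₂, hQ₂, rfl⟩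
  obtain ⟨f₁, ⟨hf₁, A₁, B₁, c₁, hB₁, hf₁'⟩, hp₁⟩ := hE ⟨1, Λ.map Q₁⟩ ⟨⟨1, Q₁⟩, by simp, rfl⟩
  obtain ⟨f₂, ⟨hf₂, A₂, B₂, c₂, hB₂, hf₂'⟩, hp₂⟩ := hE ⟨1, Λ.map Q₂⟩ ⟨⟨1, Q₂⟩, by simp, rfl⟩
  have hG₁ := (isPostprocessing_iff_hasParams hG hf₁').1 hp₁
  have hG₂ := (isPostprocessing_iff_hasParams hG hf₂').1 hp₂
  have hΛ₁ := hQ₁.map hΛ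
  have hΛ₂ := hQ₂.map hΛ
  let o : Fin 1 → ℝ := fun _ => 1
  have hcol : ∀ k : Phase N', replicateCol (Fin 1) k *ᵥ o = k := fun k => by
    ext i
    simp [mulVec, dotProduct, o]
  have hq₁ := (hΛ₁.dotProduct_mulVec_eq hG₁ o).1
  have hq₂ := (hΛ₂.dotProduct_mulVec_eq hG₂ o).1
  have hs := hΛ₁.omega_eq hG₁ hΛ₂ hG₂ o o
  rw [zero_add, dotProduct_conj_mulVec, hcol, add_mulVec, dotProduct_add,
    dotProduct_conj_mulVec] at hq₁ hq₂
  rw [← mulVec_mulVec, ← mulVec_mulVec, hcol, hcol, ← mulVec_mulVec, ← mulVec_mulVec] at hs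
  have hb₁ : 0 ≤ o ⬝ᵥ B₁ *ᵥ o := by
    simpa using (Matrix.posSemidef_iff_dotProduct_mulVec.1 hB₁).2 o
  have hb₂ : 0 ≤ o ⬝ᵥ B₂ *ᵥ o := by
    simpa using (Matrix.posSemidef_iff_dotProduct_mulVec.1 hB₂).2 o
  -- Admissibility of the joint observable at `aⱼ = Aⱼ o`; the nonnegative noises `Bⱼ` only enlarge
  -- the diagonal terms.
  have hfin := (posSemidef_sub_iff (isSymm_of_posSemidef_sub hKL)
    (transpose_conj_eq_neg K (Omega_transpose N))).1 hKL (A₁ *ᵥ o) (A₂ *ᵥ o)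
  rw [dotProduct_conj_mulVec, ← hs] at hfin
  rw [dotProduct_conj_mulVec, hq₁, hq₂]
  linarith

lemma isSymm_of_posSemidef_channel {A : Matrix (PhaseIdx N) (PhaseIdx N') ℝ}
    {B : Matrix (PhaseIdx N') (PhaseIdx N') ℝ}
    (h : (B.map Complex.ofReal + Complex.I • (Omega N').map Complex.ofReal -
      Complex.I • (Aᵀ * Omega N * A).map Complex.ofReal).PosSemidef) : B.IsSymm := by
  refine isSymm_of_posSemidef_sub (S := Aᵀ * Omega N * A - Omega N') ?_
  refine (congrArg Matrix.PosSemidef ?_).mpr h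
  ext i j
  simp only [Matrix.sub_apply, Matrix.add_apply, Matrix.smul_apply, Matrix.map_apply, smul_eq_mul,
    Complex.ofReal_sub]
  ring

end Main

end GaussianBreaking

theorem mainTheorem3 (N N' : ℕ)
    (Λ : GaussianBreaking.Channel (GaussianBreaking.ModeSpace N') (GaussianBreaking.ModeSpace N))
    (hΛ : Λ.IsGaussian) :
    List.TFAE [
      GaussianBreaking.BreaksGaussianIncompatibility Λ (GaussianBreaking.gaussianObservables N'),
      ∀ E₁ ∈ GaussianBreaking.gaussianObservables N', ∀ E₂ ∈ GaussianBreaking.gaussianObservables N',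
        GaussianBreaking.BreaksGaussianIncompatibility Λ {E₁, E₂},
      GaussianBreaking.BreaksGaussianIncompatibility Λ (GaussianBreaking.generalisedQuadratures N'),
      ∀ E₁ ∈ GaussianBreaking.generalisedQuadratures N',
        ∀ E₂ ∈ GaussianBreaking.generalisedQuadratures N',
          GaussianBreaking.BreaksGaussianIncompatibility Λ {E₁, E₂}] := by
  obtain ⟨A, B, c, hpos, hAB⟩ := hΛ
  tfae_have 1 → 2 := fun h E₁ h₁ E₂ h₂ => h.mono (Set.pair_subset h₁ h₂)
  tfae_have 1 → 3 := fun h => h.mono GaussianBreaking.generalisedQuadratures_subset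
  tfae_have 2 → 4 := fun h E₁ h₁ E₂ h₂ =>
    h E₁ (GaussianBreaking.generalisedQuadratures_subset h₁) E₂
      (GaussianBreaking.generalisedQuadratures_subset h₂)
  tfae_have 3 → 4 := fun h E₁ h₁ E₂ h₂ => h.mono (Set.pair_subset h₁ h₂)
  -- The only implication with content; it passes through `B - iAᵀΩA ≥ 0`.
  tfae_have 4 → 1 := fun h =>
    GaussianBreaking.breaksGaussianIncompatibility_of_posSemidef hAB
      (GaussianBreaking.posSemidef_of_breaks_pairs
        (GaussianBreaking.isSymm_of_posSemidef_channel hpos) hAB h)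
  tfae_finish
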